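/- All graphs are finite and connected, and may have loops and multiple edges. A *tile* is a finite multiset of integers, and a *pot* is a set of tiles. For a pot $P$, let $\Sigma(P)$ be the set of positive integers $n$ (the *colors*, or bond-edge types, of $P$) such that $n$ or $-n$ occurs in some tile of $P$, and let $\pm\Sigma(P)=\{n,-n : n\in\Sigma(P)\}$. Given an orientation of an undirected graph $G$ and a coloring $\lambda$ of its edges by positive integers, the tile at a vertex $x$ is the multiset that contains $\lambda(e)$ once for every non-loop edge $e$ directed out of $x$, $-\lambda(e)$ once for every non-loop edge $e$ directed into $x$, and both $\lambda(e)$ and $-\lambda(e)$ once for every loop $e$ at $x$. The pot $P$ *realizes* $G$ if there are an orientation and a coloring of $G$ such that the tiles at all vertices of $G$ belong to $P$. The pot $P$ *$3$-realizes* $G$ if $P$ realizes $G$ and $P$ realizes no graph $H\not\cong G$ with $|V(H)|\le |V(G)|$. Let $T_3(G)$ and $B_3(G)$ be the minimum of $|P|$ and the minimum of $|\Sigma(P)|$, respectively, over all pots $P$ that $3$-realize $G$. A pot $P$ that $3$-realizes $G$ is *biminimal* if $|P|=T_3(G)$ and $|\Sigma(P)|=B_3(G)$. Two pots $P,P'$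 are *isomorphic* if there is a bijection $f:\pm\Sigma(P)\to\pm\Sigma(P')$ with $f(-i)=-f(i)$ for all $i$ such that applying $f$ to the elements of the tiles of $P$ gives $f(P)=P'$. **Theorem.** Let $Q$ be the cube graph (the Cayley graph of $\mathbb{Z}_2^3$ with connection set $\{100,010,001\}$). Every biminimal pot $P$ that $3$-realizes $Q$ satisfies $|P|=6$ and $|\Sigma(P)|=5$, and is isomorphic to one of $$P_1=\big\{\{1,1,1\},\{2,2,2\},\{-2,-3,-3\},\{-1,-4,-4\},\{-1,3,-5\},\{-2,4,5\}\big\},$$ $$P_2=\big\{\{1,1,1\},\{2,2,2\},\{-2,-3,-3\},\{-1,-4,-4\},\{3,4,5\},\{-1,-2,-5\}\big\}.$$ -/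

import Mathlib

namespace PotCube

/-- A finite connected undirected graph, possibly with loops and multiple edges. A realization of a
graph with finitely many vertices only has finite tiles, so only finite edge sets matter. -/
structure MultiGraph where
  V : Type
  E : Type
  [fintypeV : Fintype V]
  [fintypeE : Fintype E]
  ends : E → Sym2 V
  nonempty : Nonempty V
  connected : ∀ x y : V, Relation.ReflTransGen (fun a b => ∃ e, ends e = s(a, b)) x y

attribute [instance] MultiGraph.fintypeV MultiGraph.fintypeE

/-- Isomorphism of undirected multigraphs. -/
def MultiGraph.Iso (G H : MultiGraph) : Prop :=
  ∃ (φ : G.V ≃ H.V) (ψ : G.E ≃ H.E), ∀ e, H.ends (ψ e) = (G.ends e).map φ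

/-- A simple connected finite graph, seen as a multigraph. -/
def MultiGraph.ofSimple {V : Type} [Fintype V] (G : SimpleGraph V) [Fintype G.edgeSet]
    (hG : G.Connected) : MultiGraph where
  V := V
  E := G.edgeSet
  ends := fun e => (e : Sym2 V)
  nonempty := hG.nonempty
  connected := fun x y => by
    have h := (SimpleGraph.reachable_iff_reflTransGen x y).1 (hG.preconnected x y)
    induction h with
    | refl => exact .refl
    | tail _ hab ih => exact ih.tail ⟨⟨_, hab⟩, rfl⟩

/-- A choice of direction (tail, head) for every edge. -/
structure Orientation (G : MultiGraph) where
  arc : G.E → G.V × G.V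
  arc_ends : ∀ e, s((arc e).1, (arc e).2) = G.ends e

open Classical in
/-- The sign at the vertex `x` of the directed edge `a`: `1` if `a` leaves `x` towards a different
vertex, `-1` if `a` enters `x` (a loop at `x` included), and `0` otherwise. -/
noncomputable def arcSign {V : Type} (a : V × V) (x : V) : ℤ :=
  if a.1 = x ∧ a.2 ≠ x then 1 else if a.2 = x then -1 else 0

open Classical in
/-- The tile induced at the vertex `x` by an edge-coloring of an orientation. A loop at `x` of color
`j` contributes both `-j` and `j`. -/
noncomputable def tile {G : MultiGraph} (o : Orientation G) (col : G.E → ℕ) (x : G.V) :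
    Multiset ℤ :=
  (Finset.univ.filter (fun e : G.E => x ∈ G.ends e)).val.map
      (fun e => arcSign (o.arc e) x * (col e : ℤ)) +
    (Finset.univ.filter (fun e : G.E => G.ends e = s(x, x))).val.map (fun e => (col e : ℤ))

/-- The pot induced by an edge-coloring of an orientation. -/
def inducedPot {G : MultiGraph} (o : Orientation G) (col : G.E → ℕ) : Set (Multiset ℤ) :=
  Set.range (tile o col)

/-- The pot `P` realizes `G`: some orientation of `G` has an edge-coloring by positive integers
all of whose induced tiles belong to `P`. -/
def Realizes (P : Set (Multiset ℤ)) (G : MultiGraph) : Prop :=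
  ∃ (o : Orientation G) (col : G.E → ℕ), (∀ e, 1 ≤ col e) ∧ inducedPot o col ⊆ P

/-- The pot `P` realizes `G` in Scenario 3. -/
def Realizes3 (P : Set (Multiset ℤ)) (G : MultiGraph) : Prop :=
  Realizes P G ∧
    ¬ ∃ H : MultiGraph, Realizes P H ∧ ¬ H.Iso G ∧ Fintype.card H.V ≤ Fintype.card G.V

/-- The set of colors (bond-edge types) of a pot: the positive integers that occur, with either
sign, in some tile of the pot. -/
def colors (P : Set (Multiset ℤ)) : Set ℕ :=
  {n | 0 < n ∧ ∃ t ∈ P, (n : ℤ) ∈ t ∨ -(n : ℤ) ∈ t}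

/-- The colors of a pot together with their negatives. -/
def signedColors (P : Set (Multiset ℤ)) : Set ℤ :=
  {z | z.natAbs ∈ colors P}

/-- The minimum size of a pot that realizes `G` in Scenario 3 (`⊤` if there is none). -/
noncomputable def T3 (G : MultiGraph) : ℕ∞ :=
  sInf {n | ∃ P : Set (Multiset ℤ), Realizes3 P G ∧ n = P.encard}

/-- The minimum number of colors of a pot that realizes `G` in Scenario 3 (`⊤` if there is none). -/
noncomputable def B3 (G : MultiGraph) : ℕ∞ :=
  sInf {n | ∃ P : Set (Multiset ℤ), Realizes3 P G ∧ n = (colors P).encard}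

/-- `P` is a biminimal pot that realizes `G` in Scenario 3. -/
def IsBiminimal3 (P : Set (Multiset ℤ)) (G : MultiGraph) : Prop :=
  Realizes3 P G ∧ P.encard = T3 G ∧ (colors P).encard = B3 G

/-- Isomorphism of pots. The bijection between the signed colors is written as the restriction
of an odd map on the integers, which every odd map between these sets is. -/
def PotIso (P P' : Set (Multiset ℤ)) : Prop :=
  ∃ f : ℤ → ℤ, (∀ z, f (-z) = -f z) ∧ Set.BijOn f (signedColors P) (signedColors P') ∧
    Multiset.map f '' P = P'

/-- The cube as the Cayley graph of `(ℤ/2)³` with connection set `{100, 010, 001}`. -/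
def cubeSimple : SimpleGraph (ZMod 2 × ZMod 2 × ZMod 2) :=
  SimpleGraph.addCayley {(1, 0, 0), (0, 1, 0), (0, 0, 1)}

theorem cubeSimple_adj_iff (u v : ZMod 2 × ZMod 2 × ZMod 2) :
    cubeSimple.Adj u v ↔ u - v = (1, 0, 0) ∨ u - v = (0, 1, 0) ∨ u - v = (0, 0, 1) := by
  simp only [cubeSimple, SimpleGraph.addCayley_adj', Set.mem_insert_iff, Set.mem_singleton_iff,
    exists_eq_or_imp, exists_eq_left]
  revert u v
  decide

instance : DecidableRel cubeSimple.Adj := fun u v => decidable_of_iff' _ (cubeSimple_adj_iff u v)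

theorem cubeSimple_connected : cubeSimple.Connected := by
  decide

/-- The cube as a multigraph. -/
def cube : MultiGraph := MultiGraph.ofSimple cubeSimple cubeSimple_connected

def P₁ : Set (Multiset ℤ) :=
  {{1, 1, 1}, {2, 2, 2}, {-2, -3, -3}, {-1, -4, -4}, {-1, 3, -5}, {-2, 4, 5}}

def P₂ : Set (Multiset ℤ) :=
  {{1, 1, 1}, {2, 2, 2}, {-2, -3, -3}, {-1, -4, -4}, {3, 4, 5}, {-1, -2, -5}}

end PotCube

namespace PotCube

/-! Exchanging the heads of two arcs of one color changes no tile and no vertex count. Since the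
cube minus two edges is connected, the exchange yields a connected graph, which must again be a cube
if the pot 3-realizes the cube. Simplicity and bipartiteness of the new graph then force the two
arcs to share a tail, share a head, or be antipodal with reversed direction
(`compatible_of_realizes3`). From there on only signed labels on darts obeying this local rule
(`IsCompatible`) matter.

Under the rule, two distinct vertices with equal tiles are at distance two, and the matching of
their darts is forced (`IsTwin`). All such pairs have the same direction and no two of them lie on a
common face (`eq_of_twinCompat`). A pot with at most six tiles therefore needs two pairs, up to
symmetry `000`, `110` together with `001`, `111` or with `011`, `101`. The second choice forces six
colors. The first forces five, uses exactly six tiles, and leaves two edges, each with two possible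
labels; the four outcomes are recolorings of `P₁` and `P₂`.

The bounds six and five come from `P₂`: color balance in a graph with at most eight vertices fixes
how often each of its tiles occurs, and the edges are then determined up to isomorphism
(`iso_cube_of_realizes_P₂`). By minimality a biminimal pot consists of the tiles used in one
realization of the cube, so the classification applies to it. -/

/-- The vertices of the cube. -/
abbrev Vert : Type := ZMod 2 × ZMod 2 × ZMod 2

/-! ### Tiles as sums over arcs -/

section Tile

/-- Sums over all edges can be compared edge by edge and reindexed by a permutation of the edges. -/
theorem map_filter_univ_eq_sum {α β : Type*} [Fintype α] (p : α → Prop) [DecidablePred p]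
    (f : α → β) :
    (Finset.univ.filter p).val.map f = ∑ a, if p a then ({f a} : Multiset β) else 0 := by
  rw [← Finset.sum_filter, Finset.sum_eq_multiset_sum, ← Multiset.sum_map_singleton
    (Multiset.map f _), Multiset.map_map]
  rfl

open Classical in
/-- The tile at `x` collects the colors of the arcs leaving `x` and the negatives of the colors of
the arcs entering `x`. -/
theorem tile_eq_out_add_in {G : MultiGraph} (o : Orientation G) (col : G.E → ℕ) (x : G.V) :
    tile o col x =
      (Finset.univ.filter fun e => (o.arc e).1 = x).val.map (fun e => (col e : ℤ)) +
        (Finset.univ.filter fun e => (o.arc e).2 = x).val.map (fun e => -(col e : ℤ)) := by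
  unfold tile
  rw [map_filter_univ_eq_sum, map_filter_univ_eq_sum, map_filter_univ_eq_sum,
    map_filter_univ_eq_sum, ← Finset.sum_add_distrib, ← Finset.sum_add_distrib]
  refine Finset.sum_congr rfl fun e _ => ?_
  rw [← o.arc_ends e]
  rcases o.arc e with ⟨u, v⟩
  simp only [arcSign, Sym2.mem_iff, Sym2.eq_iff]
  rw [eq_comm (a := x), eq_comm (a := x)]
  by_cases hu : u = x <;> by_cases hv : v = x <;> simp [hu, hv]
  -- Only the loop case remains: `tile` lists the negative label first.
  exact Multiset.pair_comm _ _

end Tile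

/-! ### Edges and signed dart labels of the cube -/

/-- The unit vectors, which are the directions of the edges of the cube. -/
def dir (i : Fin 3) : Vert := ![(1, 0, 0), (0, 1, 0), (0, 0, 1)] i

/-- The all-ones vector, the difference of antipodal vertices. -/
def ones : Vert := (1, 1, 1)

theorem dir_injective : Function.Injective dir := by
  intro i j
  revert i j; decide

theorem adj_dir (x : Vert) (i : Fin 3) : cubeSimple.Adj x (x + dir i) := by
  revert x i; decide

/-- The edge of the cube at `x` in direction `i`. -/
def edge (x : Vert) (i : Fin 3) : cube.E :=
  (⟨s(x, x + dir i), adj_dir x i⟩ : cubeSimple.edgeSet)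

/-- The pair of ends of an edge of the cube. -/
def cubeEnds (e : cube.E) : Sym2 Vert := cube.ends e

/-- The arc of an edge in an orientation of the cube. -/
def cubeArc (o : Orientation cube) (e : cube.E) : Vert × Vert := o.arc e

theorem mk_cubeArc (o : Orientation cube) (e : cube.E) :
    s((cubeArc o e).1, (cubeArc o e).2) = cubeEnds e := o.arc_ends e

theorem ends_edge (x : Vert) (i : Fin 3) : cubeEnds (edge x i) = s(x, x + dir i) := rfl

theorem ends_cube_injective : Function.Injective cubeEnds := Subtype.val_injective

theorem add_dir_add_dir (x : Vert) (i : Fin 3) : x + dir i + dir i = x := by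
  revert x i; decide

theorem edge_add_dir (x : Vert) (i : Fin 3) : edge (x + dir i) i = edge x i := by
  apply ends_cube_injective
  rw [ends_edge, ends_edge]
  rw [add_dir_add_dir, Sym2.eq_swap]

theorem exists_dir_of_adj {u v : Vert} (h : cubeSimple.Adj u v) : ∃ i, v = u + dir i := by
  revert u v; decide

theorem exists_eq_edge_of_ends {e : cube.E} {u v : Vert} (h : cubeEnds e = s(u, v)) :
    ∃ i, v = u + dir i ∧ e = edge u i := by
  have hadj : cubeSimple.Adj u v := by
    have := e.2
    rw [show (e.1 : Sym2 Vert) = s(u, v) from h] at this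
    exact this
  obtain ⟨i, rfl⟩ := exists_dir_of_adj hadj
  exact ⟨i, rfl, ends_cube_injective h⟩

theorem exists_eq_edge_of_mem {e : cube.E} {u : Vert} (h : u ∈ cubeEnds e) :
    ∃ i, e = edge u i := by
  obtain ⟨v, hv⟩ := h
  obtain ⟨i, -, h⟩ := exists_eq_edge_of_ends hv
  exact ⟨i, h⟩

theorem dir_ne_zero (x : Vert) (i : Fin 3) : x + dir i ≠ x := by
  revert x i; decide

theorem edge_eq_edge_iff {x y : Vert} {i j : Fin 3} :
    edge x i = edge y j ↔ i = j ∧ (y = x ∨ y = x + dir i) := by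
  constructor
  · intro h
    have := congrArg cubeEnds h
    rw [ends_edge, ends_edge, Sym2.eq_iff] at this
    clear h
    rcases this with ⟨rfl, h⟩ | ⟨rfl, h⟩
    · exact ⟨dir_injective (add_left_cancel h), .inl rfl⟩
    · revert y i j
      decide
  · rintro ⟨rfl, rfl | rfl⟩
    · rfl
    · rw [edge_add_dir]

theorem edge_injective (x : Vert) : Function.Injective (edge x) :=
  fun _ _ h => (edge_eq_edge_iff.1 h).1

theorem exists_eq_edge (e : cube.E) : ∃ x i, e = edge x i := by
  obtain ⟨⟨u, v⟩, huv⟩ := Quot.exists_rep (cubeEnds e)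
  obtain ⟨i, -, h⟩ := exists_eq_edge_of_ends (u := u) (v := v) huv.symm
  exact ⟨u, i, h⟩

/-- The color of the edge at `x` in direction `i`, with the sign it has in the tile of `x`. -/
noncomputable def label (o : Orientation cube) (col : cube.E → ℕ) (x : Vert) (i : Fin 3) : ℤ :=
  arcSign (cubeArc o (edge x i)) x * (col (edge x i) : ℤ)

theorem arc_edge (o : Orientation cube) (x : Vert) (i : Fin 3) :
    cubeArc o (edge x i) = (x, x + dir i) ∨ cubeArc o (edge x i) = (x + dir i, x) := by
  have h := mk_cubeArc o (edge x i)
  rw [ends_edge, Sym2.eq_iff] at h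
  rcases h with h | h
  · exact Or.inl (Prod.ext h.1 h.2)
  · exact Or.inr (Prod.ext h.1 h.2)

theorem label_of_out {o : Orientation cube} {col : cube.E → ℕ} {x : Vert} {i : Fin 3}
    (h : cubeArc o (edge x i) = (x, x + dir i)) : label o col x i = col (edge x i) := by
  unfold label
  rw [h]
  simp only [arcSign, dir_ne_zero, ne_eq, not_false_eq_true, and_self, if_true, one_mul]

theorem label_of_in {o : Orientation cube} {col : cube.E → ℕ} {x : Vert} {i : Fin 3}
    (h : cubeArc o (edge x i) = (x + dir i, x)) : label o col x i = -col (edge x i) := by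
  unfold label
  rw [h]
  simp [arcSign]

theorem label_add_dir (o : Orientation cube) (col : cube.E → ℕ) (x : Vert) (i : Fin 3) :
    label o col (x + dir i) i = -label o col x i := by
  rcases arc_edge o x i with h | h
  · rw [label_of_out h, label_of_in, edge_add_dir]
    rw [edge_add_dir, add_dir_add_dir, h]
  · rw [label_of_in h, label_of_out, edge_add_dir, neg_neg]
    rw [edge_add_dir, add_dir_add_dir, h]

theorem tile_cube (o : Orientation cube) (col : cube.E → ℕ) (x : Vert) :
    tile o col x = {label o col x 0, label o col x 1, label o col x 2} := by
  classical
  have h1 [DecidablePred fun e : cube.E => x ∈ cubeEnds e] :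
      (Finset.univ.filter fun e : cube.E => x ∈ cubeEnds e) =
        Finset.univ.map ⟨edge x, edge_injective x⟩ := by
    ext e
    simp only [Finset.mem_filter, Finset.mem_univ, true_and, Finset.mem_map,
      Function.Embedding.coeFn_mk]
    constructor
    · intro h
      obtain ⟨i, hi⟩ := exists_eq_edge_of_mem h
      exact ⟨i, hi.symm⟩
    · rintro ⟨i, rfl⟩
      exact Sym2.mem_mk_left _ _
  have h2 [DecidablePred fun e : cube.E => cubeEnds e = s(x, x)] :
      (Finset.univ.filter fun e : cube.E => cubeEnds e = s(x, x)) = ∅ := by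
    refine Finset.filter_eq_empty_iff.2 fun e _ h => ?_
    obtain ⟨i, hi, -⟩ := exists_eq_edge_of_ends h
    exact dir_ne_zero x i hi.symm
  unfold tile
  have h1' [DecidablePred fun e : cube.E => x ∈ cubeEnds e] :
      (Finset.univ.filter fun e : cube.E => x ∈ cubeEnds e).val.map
        (fun e => arcSign (cubeArc o e) x * (col e : ℤ)) =
      {label o col x 0, label o col x 1, label o col x 2} := by
    rw [h1, Finset.map_val, Multiset.map_map]
    rfl
  have h2' [DecidablePred fun e : cube.E => cubeEnds e = s(x, x)] :
      (Finset.univ.filter fun e : cube.E => cubeEnds e = s(x, x)).val.map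
        (fun e => (col e : ℤ)) = 0 := by
    rw [h2]; rfl
  refine Eq.trans ?_ ((congrArg₂ (· + ·) h1' h2').trans (add_zero _))
  congr!

/-- Every odd nonvanishing labelling of the darts of the cube comes from an orientation and an
edge-coloring. -/
theorem exists_label_eq (l : Vert → Fin 3 → ℤ) (hodd : ∀ x i, l (x + dir i) i = -l x i)
    (hne : ∀ x i, l x i ≠ 0) :
    ∃ (o : Orientation cube) (col : cube.E → ℕ), (∀ e, 1 ≤ col e) ∧ label o col = l := by
  -- By oddness one end of each edge sees a positive label; that end becomes the tail.
  have key : ∀ e : cube.E, ∃ p : Vert × Fin 3, edge p.1 p.2 = e ∧ 0 < l p.1 p.2 := by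
    intro e
    obtain ⟨u, i, rfl⟩ := exists_eq_edge e
    rcases lt_or_gt_of_ne (hne u i) with h | h
    · exact ⟨(u + dir i, i), edge_add_dir u i, by simpa [hodd] using h⟩
    · exact ⟨(u, i), rfl, h⟩
  choose p hp hpos using key
  refine ⟨⟨fun e => (show Vert × Vert from ((p e).1, (p e).1 + dir (p e).2)), fun e => ?_⟩,
    fun e => (l (p e).1 (p e).2).natAbs, fun e => ?_, ?_⟩
  · conv_rhs => rw [← hp e]
    rfl
  · have := hpos e
    simp only
    omega
  · funext x i
    have h := hp (edge x i)
    have hq := hpos (edge x i)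
    have : (p (edge x i) = (x, i)) ∨ (p (edge x i) = (x + dir i, i)) := by
      obtain ⟨hi, hx⟩ := edge_eq_edge_iff.1 h.symm
      exact hx.imp (fun h => Prod.ext h hi.symm) (fun h => Prod.ext h hi.symm)
    rcases this with hx | hx
    · rw [label_of_out (by unfold cubeArc; simp only [hx])]
      simp only [hx] at hq ⊢
      omega
    · rw [label_of_in (by unfold cubeArc; simp only [hx, add_dir_add_dir])]
      simp only [hx, hodd] at hq ⊢
      omega

/-! ### Exchanging the heads of two arcs -/

set_option synthInstance.maxSize 1000 in
set_option maxRecDepth 4000 in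
-- The two squares through an edge have only that edge in common, so a second forbidden edge blocks
-- at most one of the two ways around.
theorem exists_detour (x : Vert) (i : Fin 3) (y : Vert) (m : Fin 3) :
    ∃ j, i ≠ j ∧ ¬ (j = m ∧ (y = x ∨ y = x + dir j)) ∧
      ¬ (i = m ∧ (y = x + dir j ∨ y = x + dir j + dir i)) ∧
      ¬ (j = m ∧ (y = x + dir i ∨ y = x + dir i + dir j)) := by
  revert x i y m; decide

/-- The cube stays connected when two edges are removed. -/
theorem reflTransGen_avoiding (e e' : cube.E) (x y : Vert) :
    Relation.ReflTransGen (fun a b => ∃ f, f ≠ e ∧ f ≠ e' ∧ cubeEnds f = s(a, b)) x y := by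
  have detour : ∀ (x : Vert) (i : Fin 3) (e' : cube.E), Relation.ReflTransGen
      (fun a b => ∃ f, f ≠ edge x i ∧ f ≠ e' ∧ cubeEnds f = s(a, b)) x (x + dir i) := by
    intro x i e'
    obtain ⟨y, m, rfl⟩ := exists_eq_edge e'
    obtain ⟨j, hij, h1, h2, h3⟩ := exists_detour x i y m
    refine .tail (b := x + dir j + dir i) (.tail (b := x + dir j) (.single ?_) ?_) ?_
    · refine ⟨edge x j, ?_, ?_, rfl⟩ <;> rw [ne_eq, edge_eq_edge_iff]
      · exact fun h => hij h.1.symm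
      · exact h1
    · refine ⟨edge (x + dir j) i, ?_, ?_, rfl⟩ <;> rw [ne_eq, edge_eq_edge_iff]
      · clear h1 h2 h3
        revert x i j; decide
      · exact h2
    · refine ⟨edge (x + dir i) j, ?_, ?_, ?_⟩
      · rw [ne_eq, edge_eq_edge_iff]
        exact fun h => hij h.1.symm
      · rw [ne_eq, edge_eq_edge_iff]
        exact h3
      · rw [ends_edge, Sym2.eq_swap, add_right_comm]
  have h := cube.connected x y
  induction h with
  | refl => exact .refl
  | @tail b c _ hbc ih =>
    obtain ⟨f, hf⟩ := hbc
    obtain ⟨i, rfl, rfl⟩ := exists_eq_edge_of_ends hf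
    refine ih.trans ?_
    by_cases h1 : edge b i = e
    · subst h1
      exact detour b i e'
    · by_cases h2 : edge b i = e'
      · subst h2
        exact Relation.ReflTransGen.mono (fun _ _ ⟨f, hf⟩ => ⟨f, hf.2.1, hf.1, hf.2.2⟩) _ _
          (detour b i e)
      · exact .single ⟨_, h1, h2, rfl⟩

open Classical in
/-- The arcs obtained from those of an oriented cube by exchanging the heads of `e` and `e'`. -/
noncomputable def swapArc (o : Orientation cube) (e e' f : cube.E) : Vert × Vert :=
  ((cubeArc o f).1, (cubeArc o (Equiv.swap e e' f)).2)

theorem swapArc_left (o : Orientation cube) (e e' : cube.E) :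
    swapArc o e e' e = ((cubeArc o e).1, (cubeArc o e').2) := by
  classical rw [swapArc, Equiv.swap_apply_left]

theorem swapArc_right (o : Orientation cube) (e e' : cube.E) :
    swapArc o e e' e' = ((cubeArc o e').1, (cubeArc o e).2) := by
  classical rw [swapArc, Equiv.swap_apply_right]

theorem swapArc_of_ne (o : Orientation cube) {e e' f : cube.E} (h : f ≠ e) (h' : f ≠ e') :
    swapArc o e e' f = cubeArc o f := by
  classical rw [swapArc, Equiv.swap_apply_of_ne_of_ne h h']

/-- The graph obtained from an oriented cube by exchanging the heads of two arcs. -/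
noncomputable def swapGraph (o : Orientation cube) (e e' : cube.E) : MultiGraph where
  V := Vert
  E := cube.E
  ends f := s((swapArc o e e' f).1, (swapArc o e e' f).2)
  nonempty := ⟨0⟩
  connected x y := by
    refine Relation.ReflTransGen.mono ?_ _ _ (reflTransGen_avoiding e e' x y)
    rintro a b ⟨f, h1, h2, hf⟩
    refine ⟨f, ?_⟩
    rw [swapArc_of_ne o h1 h2, mk_cubeArc, hf]

/-- Outgoing labels are untouched, and incoming ones are permuted by a transposition of two edges of
equal color. -/
theorem realizes_swapGraph {P : Set (Multiset ℤ)} {o : Orientation cube} {col : cube.E → ℕ}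
    (hcol : ∀ e, 1 ≤ col e) (hP : inducedPot o col ⊆ P) {e e' : cube.E} (h : col e = col e') :
    Realizes P (swapGraph o e e') := by
  classical
  refine ⟨⟨swapArc o e e', fun _ => rfl⟩, col, hcol, ?_⟩
  rintro _ ⟨x, rfl⟩
  refine hP ⟨x, ?_⟩
  refine (tile_eq_out_add_in (G := cube) o col x).trans
    (Eq.trans ?_ (tile_eq_out_add_in (G := swapGraph o e e') _ col x).symm)
  rw [map_filter_univ_eq_sum, map_filter_univ_eq_sum, map_filter_univ_eq_sum,
    map_filter_univ_eq_sum]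
  refine congrArg₂ (· + ·) rfl ?_
  refine (Fintype.sum_equiv (Equiv.swap e e') _ _ fun f => ?_).symm
  have : col (Equiv.swap e e' f) = col f := by
    rw [Equiv.swap_apply_def]
    split_ifs with h1 h2
    · rw [h1, h]
    · rw [h2, h]
    · rfl
  rw [this]
  have hx : (swapArc o e e' f).2 = (cubeArc o (Equiv.swap e e' f)).2 := by
    unfold swapArc; congr!
  change (if (swapArc o e e' f).2 = x then _ else _) = if (cubeArc o _).2 = x then _ else _
  simp only [hx]

/-! ### The local rule for equal labels -/

/-- The parity of the coordinate sum. -/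
def parity (x : Vert) : ZMod 2 := x.1 + x.2.1 + x.2.2

theorem parity_add_dir : ∀ (x : Vert) (i : Fin 3), parity x ≠ parity (x + dir i) := by decide

theorem arc_parity (o : Orientation cube) (e : cube.E) :
    parity (cubeArc o e).1 ≠ parity (cubeArc o e).2 := by
  obtain ⟨i, hi, -⟩ := exists_eq_edge_of_ends (mk_cubeArc o e).symm
  rw [hi]
  exact parity_add_dir _ i

theorem add_eq_add_of_ne_of_ne : ∀ a b c d : ZMod 2, a ≠ b → c ≠ d → a + c = b + d := by decide

/-- Absence of parallel edges and bipartiteness are the only invariants needed to detect a bad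
exchange. -/
theorem iso_cube_properties {G : MultiGraph} (h : G.Iso cube) :
    Function.Injective G.ends ∧
      ∃ f : G.V → ZMod 2, ∀ e a b, G.ends e = s(a, b) → f a ≠ f b := by
  obtain ⟨φ, ψ, h⟩ := h
  refine ⟨fun e e' he => ψ.injective (ends_cube_injective ?_), fun a => parity (φ a),
    fun e a b hab => ?_⟩
  · exact (h e).trans ((congrArg _ he).trans (h e').symm)
  · have h' := h e
    rw [hab, Sym2.map_mk] at h'
    obtain ⟨i, hi, -⟩ := exists_eq_edge_of_ends h'
    change parity (φ a) ≠ parity (φ b)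
    exact hi ▸ parity_add_dir _ i

/-- In a labelling of the cube that witnesses a pot realizing it in Scenario 3, two arcs `u → v` and
`x → y` of one color share their tail, share their head, or satisfy `y = u + ones` and
`x = v + ones`: otherwise exchanging their heads gives a different graph. -/
theorem compatible_of_realizes3 {P : Set (Multiset ℤ)} (hP : Realizes3 P cube)
    {o : Orientation cube} {col : cube.E → ℕ} (hcol : ∀ e, 1 ≤ col e) (hsub : inducedPot o col ⊆ P)
    {e e' : cube.E} (h : col e = col e') {u v x y : Vert}
    (he : cubeArc o e = (u, v)) (he' : cubeArc o e' = (x, y)) :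
    u = x ∨ v = y ∨ (y = u + ones ∧ x = v + ones) := by
  have hiso : (swapGraph o e e').Iso cube := by
    by_contra hn
    exact hP.2 ⟨_, realizes_swapGraph hcol hsub h, hn, le_rfl⟩
  obtain ⟨hinj, f, hf⟩ := iso_cube_properties hiso
  replace hinj : Function.Injective
    fun g => s((swapArc o e e' g).1, (swapArc o e e' g).2) := hinj
  replace hf : ∀ g, f (swapArc o e e' g).1 ≠ f (swapArc o e e' g).2 := fun g => hf g _ _ rfl
  change Vert → ZMod 2 at f
  have hother : ∀ g, g ≠ e → g ≠ e' → s((swapArc o e e' g).1, (swapArc o e e' g).2) = cubeEnds g :=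
    fun g h1 h2 => by rw [swapArc_of_ne o h1 h2, mk_cubeArc]
  have hswap1 : swapArc o e e' e = (u, y) := by rw [swapArc_left, he, he']
  have hswap2 : swapArc o e e' e' = (x, v) := by rw [swapArc_right, he, he']
  have he1 : cubeEnds e = s(u, v) := by rw [← mk_cubeArc o e, he]
  have he2 : cubeEnds e' = s(x, y) := by rw [← mk_cubeArc o e', he']
  -- Along every unchanged edge both `f` and `parity` flip, and these edges connect the cube; so `f`
  -- is `parity` up to a constant.
  have hpar : ∀ a b : Vert, f a + parity a = f b + parity b := by
    intro a b
    induction reflTransGen_avoiding e e' a b with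
    | refl => rfl
    | tail _ h ih =>
      obtain ⟨g, h1, h2, hg⟩ := h
      rw [ih]
      have h3 := hf g
      rw [swapArc_of_ne o h1 h2] at h3
      rw [← mk_cubeArc o, Sym2.eq_iff] at hg
      have h4 := arc_parity o g
      rcases hg with ⟨hb, hc⟩ | ⟨hc, hb⟩ <;> rw [hb, hc] at h3 h4 <;> revert h3 h4
      · exact add_eq_add_of_ne_of_ne _ _ _ _
      · intro h3 h4
        exact (add_eq_add_of_ne_of_ne _ _ _ _ h3 h4).symm
  -- Vertices of opposite parity are at distance one or three.
  have hedge : ∀ a b, f a ≠ f b → (∃ i, b = a + dir i) ∨ b = a + ones := by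
    intro a b hab
    have hpar := hpar a b
    have : parity a ≠ parity b := fun h => hab (add_right_cancel (h ▸ hpar))
    clear hpar hab
    revert a b; decide
  -- If a new arc joins neighbours, the cube edge between them must be `e` or `e'`, since any other
  -- would be parallel to the new arc.
  have hshare : ∀ i, y = u + dir i ∨ v = x + dir i → u = x ∨ v = y := by
    have hne1 : ∀ g, cubeEnds g = s(u, y) → u = x ∨ v = y := fun g hg => by
      by_cases h1 : g = e
      · rw [h1, he1, Sym2.congr_right] at hg
        exact .inr hg
      by_cases h2 : g = e'
      · rw [h2, he2, Sym2.congr_left] at hg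
        exact .inl hg.symm
      · refine absurd (hinj (a₁ := g) (a₂ := e) ?_) h1
        simp only [hother g h1 h2, hg, hswap1]
    have hne2 : ∀ g, cubeEnds g = s(x, v) → u = x ∨ v = y := fun g hg => by
      by_cases h1 : g = e
      · rw [h1, he1, Sym2.congr_left] at hg
        exact .inl hg
      by_cases h2 : g = e'
      · rw [h2, he2, Sym2.congr_right] at hg
        exact .inr hg.symm
      · refine absurd (hinj (a₁ := g) (a₂ := e') ?_) h2
        simp only [hother g h1 h2, hg, hswap2]
    rintro i (rfl | rfl)
    · exact hne1 (edge u i) rfl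
    · exact hne2 (edge x i) rfl
  have h1 := hf e
  have h2 := hf e'
  rw [hswap1] at h1
  rw [hswap2] at h2
  rcases hedge u y h1 with ⟨i, hi⟩ | hy
  · exact (hshare i (.inl hi)).imp_right .inl
  · rcases hedge v x h2.symm with ⟨i, hi⟩ | hx
    · exact (hshare i (.inr (by rw [hi, add_dir_add_dir]))).imp_right .inl
    · exact .inr (.inr ⟨hy, hx⟩)

/-- A labelling of the darts of the cube in which equal labels sit only on darts that share their
tail, share their head, or are exchanged by the antipodal map composed with reversal. -/
structure IsCompatible (l : Vert → Fin 3 → ℤ) : Prop where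
  odd : ∀ x i, l (x + dir i) i = -l x i
  ne_zero : ∀ x i, l x i ≠ 0
  eq_or : ∀ x i y j, l x i = l y j →
    x = y ∨ x + dir i = y + dir j ∨ (i = j ∧ y = x + dir i + ones)

theorem isCompatible_label {P : Set (Multiset ℤ)} (hP : Realizes3 P cube)
    {o : Orientation cube} {col : cube.E → ℕ} (hcol : ∀ e, 1 ≤ col e)
    (hsub : inducedPot o col ⊆ P) : IsCompatible (label o col) where
  odd := label_add_dir o col
  ne_zero x i := by
    have := hcol (edge x i)
    rcases arc_edge o x i with h | h
    · rw [label_of_out h]; omega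
    · rw [label_of_in h]; omega
  eq_or x i y j h := by
    have h1 := hcol (edge x i)
    have h2 := hcol (edge y j)
    -- The two antipodality equations together force equal directions.
    have aux : (x = y ∨ x + dir i = y + dir j ∨
        (y + dir j = x + ones ∧ y = x + dir i + ones)) →
        x = y ∨ x + dir i = y + dir j ∨ (i = j ∧ y = x + dir i + ones) := by
      clear h h1 h2
      revert x i y j; decide
    by_cases he : edge x i = edge y j
    · rw [edge_eq_edge_iff] at he
      obtain ⟨rfl, rfl | rfl⟩ := he
      · exact .inl rfl
      · rcases arc_edge o x i with hx | hx
        all_goals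
          have := label_add_dir o col x i
          rw [← h] at this
          first | rw [label_of_out hx] at this; omega | rw [label_of_in hx] at this; omega
    · rcases arc_edge o x i with hx | hx <;> rcases arc_edge o y j with hy | hy
      · rw [label_of_out hx, label_of_out hy] at h
        exact aux (compatible_of_realizes3 hP hcol hsub (by omega) hx hy)
      · rw [label_of_out hx, label_of_in hy] at h; omega
      · rw [label_of_in hx, label_of_out hy] at h; omega
      · rw [label_of_in hx, label_of_in hy] at h
        -- For incoming arcs, tail and head trade places, which only permutes the alternatives.
        have := compatible_of_realizes3 hP hcol hsub (by omega) hx hy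
        refine aux ?_
        tauto

/-! ### Counting labels in tiles -/

section Count

variable {G : MultiGraph} (o : Orientation G) (col : G.E → ℕ)

open Classical in
theorem count_tile_of_pos {n : ℕ} (hn : 0 < n) (x : G.V) :
    (tile o col x).count (n : ℤ) =
      (Finset.univ.filter fun e => (o.arc e).1 = x ∧ col e = n).card := by
  rw [tile_eq_out_add_in, Multiset.count_add, Multiset.count_map, Multiset.count_map,
    ← Finset.filter_val, ← Finset.filter_val, Finset.card_val, Finset.card_val,
    Finset.filter_filter, Finset.filter_filter,
    (Finset.card_eq_zero (s := Finset.univ.filter fun e => (o.arc e).2 = x ∧ _)).2, add_zero]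
  · simp only [Nat.cast_inj, eq_comm (a := n)]
  · refine Finset.filter_eq_empty_iff.2 fun e _ h => ?_
    have := h.2
    omega

open Classical in
theorem count_tile_neg_of_pos {n : ℕ} (hn : 0 < n) (x : G.V) :
    (tile o col x).count (-(n : ℤ)) =
      (Finset.univ.filter fun e => (o.arc e).2 = x ∧ col e = n).card := by
  rw [tile_eq_out_add_in, Multiset.count_add, Multiset.count_map, Multiset.count_map,
    ← Finset.filter_val, ← Finset.filter_val, Finset.card_val, Finset.card_val,
    Finset.filter_filter, Finset.filter_filter, Finset.card_eq_zero.2, zero_add]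
  · simp only [neg_inj, Nat.cast_inj, eq_comm (a := n)]
  · refine Finset.filter_eq_empty_iff.2 fun e _ h => ?_
    have := h.2
    omega

/-- Each edge of color `n` puts one `n` at its tail and one `-n` at its head. -/
theorem sum_count_tile {n : ℕ} (hn : 0 < n) :
    ∑ x, (tile o col x).count (n : ℤ) = ∑ x, (tile o col x).count (-(n : ℤ)) := by
  classical
  simp only [count_tile_of_pos o col hn, count_tile_neg_of_pos o col hn]
  have h1 := Finset.card_eq_sum_card_fiberwise (s := Finset.univ.filter fun e => col e = n)
    (t := Finset.univ) (f := fun e => (o.arc e).1) fun _ _ => Finset.mem_coe.2 (Finset.mem_univ _)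
  have h2 := Finset.card_eq_sum_card_fiberwise (s := Finset.univ.filter fun e => col e = n)
    (t := Finset.univ) (f := fun e => (o.arc e).2) fun _ _ => Finset.mem_coe.2 (Finset.mem_univ _)
  rw [h1] at h2
  simpa only [Finset.filter_filter, and_comm] using h2

/-- The handshaking lemma. -/
theorem sum_card_tile : ∑ x, (tile o col x).card = 2 * Fintype.card G.E := by
  classical
  simp only [tile_eq_out_add_in, Multiset.card_add, Multiset.card_map, Finset.card_val,
    Finset.sum_add_distrib]
  have h1 := Finset.card_eq_sum_card_fiberwise (s := (Finset.univ : Finset G.E))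
    (t := Finset.univ) (f := fun e => (o.arc e).1) fun _ _ => Finset.mem_coe.2 (Finset.mem_univ _)
  have h2 := Finset.card_eq_sum_card_fiberwise (s := (Finset.univ : Finset G.E))
    (t := Finset.univ) (f := fun e => (o.arc e).2) fun _ _ => Finset.mem_coe.2 (Finset.mem_univ _)
  rw [two_mul]
  nth_rw 1 [← Finset.card_univ, ← Finset.card_univ, h1, h2]

variable {o col}

theorem exists_arc_of_mem_tile {n : ℕ} (hn : 0 < n) {x : G.V} (h : (n : ℤ) ∈ tile o col x) :
    ∃ e, (o.arc e).1 = x ∧ col e = n := by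
  classical
  rw [← Multiset.count_pos, count_tile_of_pos o col hn, Finset.card_pos] at h
  obtain ⟨e, he⟩ := h
  exact ⟨e, (Finset.mem_filter.1 he).2⟩

theorem exists_arc_of_neg_mem_tile {n : ℕ} (hn : 0 < n) {x : G.V}
    (h : -(n : ℤ) ∈ tile o col x) : ∃ e, (o.arc e).2 = x ∧ col e = n := by
  classical
  rw [← Multiset.count_pos, count_tile_neg_of_pos o col hn, Finset.card_pos] at h
  obtain ⟨e, he⟩ := h
  exact ⟨e, (Finset.mem_filter.1 he).2⟩

theorem mem_tile_tail (e : G.E) : (col e : ℤ) ∈ tile o col (o.arc e).1 := by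
  classical
  rw [tile_eq_out_add_in, Multiset.mem_add]
  exact .inl (Multiset.mem_map.2 ⟨e, by simp, rfl⟩)

theorem neg_mem_tile_head (e : G.E) : -(col e : ℤ) ∈ tile o col (o.arc e).2 := by
  classical
  rw [tile_eq_out_add_in, Multiset.mem_add]
  exact .inr (Multiset.mem_map.2 ⟨e, by simp, rfl⟩)

end Count

/-! ### `P₂` 3-realizes the cube -/

theorem card_vert : Fintype.card Vert = 8 := by decide

/-- The labelling of the cube that induces the pot `P₂`. -/
def label₂ (x : Vert) : Fin 3 → ℤ :=
  (![![![![-1, -2, -5], ![4, 3, 5]], ![![2, 2, 2], ![-3, -3, -2]]],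
    ![![![1, 1, 1], ![-4, -4, -1]], ![![-2, -1, -5], ![3, 4, 5]]]] :
      Fin 2 → Fin 2 → Fin 2 → Fin 3 → ℤ) x.1 x.2.1 x.2.2

theorem exists_label_eq_label₂ :
    ∃ (o : Orientation cube) (col : cube.E → ℕ), (∀ e, 1 ≤ col e) ∧ label o col = label₂ :=
  exists_label_eq label₂ (by decide) (by decide)

/-- Handshaking with eight tiles of size three; `label₂` merely supplies some labelling. -/
theorem card_cube_E : Fintype.card cube.E = 12 := by
  obtain ⟨o, col, -, -⟩ := exists_label_eq_label₂
  have h := sum_card_tile o col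
  have h' : ∑ x : Vert, (tile o col x).card = 24 := by
    simp only [tile_cube]
    rfl
  have := h.symm.trans h'
  omega

theorem eq_zero_of_ne_of_ne_zero : ∀ a b : ZMod 2, a ≠ b → a ≠ 0 → b = 0 := by decide

/-- Equal cardinalities leave no room for further vertices or edges. Every cube edge has an even
end, so checking adjacency from even vertices suffices. -/
theorem iso_cube_of_injective {H : MultiGraph} (hV : Fintype.card H.V = 8)
    (hE : Fintype.card H.E = 12) (g : Vert → H.V) (hg : Function.Injective g)
    (hadj : ∀ x i, parity x = 0 → ∃ e, H.ends e = s(g x, g (x + dir i))) : H.Iso cube := by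
  have key : ∀ e : cube.E, ∃ e', H.ends e' = (cubeEnds e).map g := by
    intro e
    obtain ⟨x, i, rfl⟩ := exists_eq_edge e
    by_cases hx : parity x = 0
    · obtain ⟨e', he'⟩ := hadj x i hx
      exact ⟨e', he'⟩
    · obtain ⟨e', he'⟩ := hadj (x + dir i) i
        (eq_zero_of_ne_of_ne_zero _ _ (parity_add_dir x i) hx)
      rw [add_dir_add_dir, Sym2.eq_swap] at he'
      exact ⟨e', he'⟩
  choose ψ hψ using key
  have hψi : Function.Injective ψ := fun e e' h =>
    ends_cube_injective (Sym2.map.injective hg (by rw [← hψ, ← hψ, h]))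
  have hψb : Function.Bijective ψ :=
    (Fintype.bijective_iff_injective_and_card ψ).2 ⟨hψi, by rw [card_cube_E, hE]⟩
  have hgb : Function.Bijective g :=
    (Fintype.bijective_iff_injective_and_card g).2 ⟨hg, by rw [card_vert, hV]⟩
  let γ : Vert ≃ H.V := Equiv.ofBijective g hgb
  refine ⟨γ.symm, (Equiv.ofBijective ψ hψb).symm, fun e => ?_⟩
  obtain ⟨f, rfl⟩ := hψb.2 e
  rw [Equiv.ofBijective_symm_apply_apply, hψ]
  have hinv : (γ.symm : H.V → Vert) ∘ g = id := funext fun x => γ.symm_apply_apply x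
  change cubeEnds f = Sym2.map (γ.symm : H.V → Vert) _
  rw [Sym2.map_map, hinv, Sym2.map_id, id]

/-- The tiles of the pot `P₂`. -/
def tile₂ : Fin 6 → Multiset ℤ :=
  ![{1, 1, 1}, {2, 2, 2}, {-2, -3, -3}, {-1, -4, -4}, {3, 4, 5}, {-1, -2, -5}]

theorem range_tile₂ : Set.range tile₂ = P₂ := by
  ext t
  simp only [Set.mem_range, P₂, Fin.exists_fin_succ, Set.mem_insert_iff, Set.mem_singleton_iff,
    tile₂, eq_comm (b := t)]
  simp

theorem realizes_cube_P₂ : Realizes P₂ cube := by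
  obtain ⟨o, col, hcol, h⟩ := exists_label_eq_label₂
  refine ⟨o, col, hcol, ?_⟩
  rintro _ ⟨x, rfl⟩
  have : ∀ x : Vert, ∃ k, tile₂ k = {label₂ x 0, label₂ x 1, label₂ x 2} := by decide
  obtain ⟨i, hi⟩ := this x
  rw [← range_tile₂]
  exact ⟨i, by rw [hi, ← h]; exact (tile_cube o col x).symm⟩

/-- Colors `1`, `2` have a unique source tile and `3`, `4` a unique target tile. Once each of these
tiles occurs once, only the matching by color `5` is free, and it merely numbers the vertices. -/
theorem iso_cube_of_realizes_P₂ {H : MultiGraph} (hH : Realizes P₂ H)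
    (hcard : Fintype.card H.V ≤ 8) : H.Iso cube := by
  classical
  obtain ⟨o, col, hcol, hP⟩ := hH
  have hk : ∀ x, ∃ k, tile₂ k = tile o col x := fun x => by
    have := hP ⟨x, rfl⟩
    rwa [← range_tile₂] at this
  choose k hk using hk
  let N : Fin 6 → ℕ := fun i => (Finset.univ.filter fun x => k x = i).card
  have hsum : ∀ F : Multiset ℤ → ℕ, ∑ x, F (tile o col x) = ∑ i, N i * F (tile₂ i) := by
    intro F
    simp only [← hk]
    rw [← Finset.sum_fiberwise Finset.univ k]
    refine Finset.sum_congr rfl fun i _ => ?_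
    rw [Finset.sum_congr rfl (g := fun _ => F (tile₂ i))
      fun x hx => by rw [(Finset.mem_filter.1 hx).2], Finset.sum_const, smul_eq_mul]
  have hbal : ∀ n : ℕ, 0 < n →
      ∑ i, N i * (tile₂ i).count (n : ℤ) = ∑ i, N i * (tile₂ i).count (-(n : ℤ)) := fun n hn => by
    rw [← hsum fun t => t.count (n : ℤ), ← hsum fun t => t.count (-(n : ℤ)),
      sum_count_tile o col hn]
  have h1 := hbal 1 (by norm_num)
  have h2 := hbal 2 (by norm_num)
  have h3 := hbal 3 (by norm_num)
  have h4 := hbal 4 (by norm_num)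
  have h5 := hbal 5 (by norm_num)
  have hV := hsum fun _ => 1
  have hE := hsum Multiset.card
  rw [sum_card_tile] at hE
  simp only [Fin.sum_univ_six] at h1 h2 h3 h4 h5 hV hE
  simp [tile₂] at h1 h2 h3 h4 h5 hV hE
  have hpos : 0 < Fintype.card H.V := Fintype.card_pos_iff.2 H.nonempty
  -- The balance equations make `N` a multiple of `(1, 1, 1, 1, 2, 2)`, whose sum is `8`.
  have hN0 : N 0 = 1 := by omega
  have hN1 : N 1 = 1 := by omega
  have hN2 : N 2 = 1 := by omega
  have hN3 : N 3 = 1 := by omega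
  have hN4 : N 4 = 2 := by omega
  obtain ⟨A, hA⟩ := Finset.card_eq_one.1 hN0
  obtain ⟨B, hB⟩ := Finset.card_eq_one.1 hN1
  obtain ⟨C, hC⟩ := Finset.card_eq_one.1 hN2
  obtain ⟨D, hD⟩ := Finset.card_eq_one.1 hN3
  obtain ⟨E₁, E₂, hne, hE12⟩ := Finset.card_eq_two.1 hN4
  have hkA : ∀ x, k x = 0 ↔ x = A := by simpa [Finset.ext_iff] using hA
  have hkB : ∀ x, k x = 1 ↔ x = B := by simpa [Finset.ext_iff] using hB
  have hkC : ∀ x, k x = 2 ↔ x = C := by simpa [Finset.ext_iff] using hC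
  have hkD : ∀ x, k x = 3 ↔ x = D := by simpa [Finset.ext_iff] using hD
  have hkE : ∀ x, k x = 4 ↔ x = E₁ ∨ x = E₂ := by simpa [Finset.ext_iff] using hE12
  have hin : ∀ {n : ℕ} (x i) (hn : 0 < n) (hx : -(n : ℤ) ∈ tile₂ (k x))
      (hu : ∀ j, (n : ℤ) ∈ tile₂ j → j = i), ∃ y, k y = i ∧ ∃ e, H.ends e = s(y, x) := by
    intro n x i hn hx hu
    rw [hk] at hx
    obtain ⟨e, rfl, rfl⟩ := exists_arc_of_neg_mem_tile hn hx
    exact ⟨_, hu _ (hk _ ▸ mem_tile_tail e), e, (o.arc_ends e).symm⟩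
  have hout : ∀ {n : ℕ} (x i) (hn : 0 < n) (hx : (n : ℤ) ∈ tile₂ (k x))
      (hu : ∀ j, -(n : ℤ) ∈ tile₂ j → j = i), ∃ y, k y = i ∧ ∃ e, o.arc e = (x, y) ∧ col e = n := by
    intro n x i hn hx hu
    rw [hk] at hx
    obtain ⟨e, rfl, rfl⟩ := exists_arc_of_mem_tile hn hx
    exact ⟨_, hu _ (hk _ ▸ neg_mem_tile_head e), e, rfl, rfl⟩
  have hkE₁ := (hkE E₁).2 (.inl rfl)
  have hkE₂ := (hkE E₂).2 (.inr rfl)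
  obtain ⟨F₁, hkF₁, e₁, he₁, hc₁⟩ := hout (n := 5) E₁ 5 (by norm_num)
    (by rw [hkE₁]; decide) (by decide)
  obtain ⟨F₂, hkF₂, e₂, he₂, hc₂⟩ := hout (n := 5) E₂ 5 (by norm_num)
    (by rw [hkE₂]; decide) (by decide)
  -- A tile of type `5` contains `-5` only once.
  have hF : F₁ ≠ F₂ := by
    rintro rfl
    have h := count_tile_neg_of_pos o col (n := 5) (by norm_num) F₁
    rw [← hk, hkF₁] at h
    replace h : 1 = _ := h
    obtain ⟨e, he⟩ := Finset.card_eq_one.1 h.symm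
    have h1 : e₁ ∈ ({e} : Finset H.E) := by rw [← he]; simp [he₁, hc₁]
    have h2 : e₂ ∈ ({e} : Finset H.E) := by rw [← he]; simp [he₂, hc₂]
    rw [Finset.mem_singleton] at h1 h2
    rw [h1, ← h2, he₂] at he₁
    exact hne (congrArg Prod.fst he₁).symm
  have hAin : ∀ x, -1 ∈ tile₂ (k x) → ∃ e, H.ends e = s(A, x) := fun x hx => by
    obtain ⟨y, hy, h⟩ := hin (n := 1) x 0 (by norm_num) hx (by decide)
    rwa [(hkA y).1 hy] at h
  have hBin : ∀ x, -2 ∈ tile₂ (k x) → ∃ e, H.ends e = s(B, x) := fun x hx => by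
    obtain ⟨y, hy, h⟩ := hin (n := 2) x 1 (by norm_num) hx (by decide)
    rwa [(hkB y).1 hy] at h
  have hCout : ∀ x, 3 ∈ tile₂ (k x) → ∃ e, H.ends e = s(x, C) := fun x hx => by
    obtain ⟨y, hy, e, he, -⟩ := hout (n := 3) x 2 (by norm_num) hx (by decide)
    exact ⟨e, by rw [← o.arc_ends, he, (hkC y).1 hy]⟩
  have hDout : ∀ x, 4 ∈ tile₂ (k x) → ∃ e, H.ends e = s(x, D) := fun x hx => by
    obtain ⟨y, hy, e, he, -⟩ := hout (n := 4) x 3 (by norm_num) hx (by decide)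
    exact ⟨e, by rw [← o.arc_ends, he, (hkD y).1 hy]⟩
  have hkA' := (hkA A).2 rfl
  have hkB' := (hkB B).2 rfl
  have hkC' := (hkC C).2 rfl
  have hkD' := (hkD D).2 rfl
  -- The tiles are placed as in `label₂`.
  let g : Vert → H.V := fun x =>
    (![![![F₁, E₁], ![B, C]], ![![A, D], ![F₂, E₂]]] : Fin 2 → Fin 2 → Fin 2 → H.V) x.1 x.2.1 x.2.2
  refine iso_cube_of_injective (by omega) (by omega) g ?_ ?_
  · have hkg : ∀ x, k (g x) = ![![![5, 4], ![1, 2]], ![![0, 3], ![5, 4]]] x.1 x.2.1 x.2.2 := by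
      rintro ⟨a, b, c⟩
      fin_cases a <;> fin_cases b <;> fin_cases c <;> assumption
    have hpair : ∀ x y : Vert,
        (![![![5, 4], ![1, 2]], ![![0, 3], ![5, 4]]] : Fin 2 → Fin 2 → Fin 2 → Fin 6)
          x.1 x.2.1 x.2.2 =
        (![![![5, 4], ![1, 2]], ![![0, 3], ![5, 4]]] : Fin 2 → Fin 2 → Fin 2 → Fin 6)
          y.1 y.2.1 y.2.2 →
        x = y ∨ (x = (0, 0, 0) ∧ y = (1, 1, 0)) ∨ (y = (0, 0, 0) ∧ x = (1, 1, 0)) ∨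
          (x = (0, 0, 1) ∧ y = (1, 1, 1)) ∨ (y = (0, 0, 1) ∧ x = (1, 1, 1)) := by decide
    intro x y hxy
    have hxy' := congrArg k hxy
    rw [hkg, hkg] at hxy'
    rcases hpair x y hxy' with h | ⟨rfl, rfl⟩ | ⟨rfl, rfl⟩ | ⟨rfl, rfl⟩ | ⟨rfl, rfl⟩
    · exact h
    · exact absurd hxy hF
    · exact absurd hxy.symm hF
    · exact absurd hxy hne
    · exact absurd hxy.symm hne
  · have hAF₁ := hAin F₁ (by rw [hkF₁]; decide)
    have hAF₂ := hAin F₂ (by rw [hkF₂]; decide)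
    have hAD := hAin D (by rw [hkD']; decide)
    have hBF₁ := hBin F₁ (by rw [hkF₁]; decide)
    have hBF₂ := hBin F₂ (by rw [hkF₂]; decide)
    have hBC := hBin C (by rw [hkC']; decide)
    have hCE₁ := hCout E₁ (by rw [hkE₁]; decide)
    have hCE₂ := hCout E₂ (by rw [hkE₂]; decide)
    have hDE₁ := hDout E₁ (by rw [hkE₁]; decide)
    have hDE₂ := hDout E₂ (by rw [hkE₂]; decide)
    have hEF₁ : ∃ e, H.ends e = s(E₁, F₁) := ⟨e₁, by rw [← o.arc_ends, he₁]⟩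
    have hEF₂ : ∃ e, H.ends e = s(E₂, F₂) := ⟨e₂, by rw [← o.arc_ends, he₂]⟩
    have hsymm : ∀ x y, (∃ e, H.ends e = s(x, y)) → ∃ e, H.ends e = s(y, x) :=
      fun x y ⟨e, he⟩ => ⟨e, he.trans Sym2.eq_swap⟩
    rintro ⟨a, b, c⟩ i hpar
    fin_cases a <;> fin_cases b <;> fin_cases c <;> first
      | exact absurd hpar (by decide)
      | fin_cases i <;> first | assumption | (apply hsymm; assumption)

theorem realizes3_cube_P₂ : Realizes3 P₂ cube :=
  ⟨realizes_cube_P₂, fun ⟨_, hH, hn, hcard⟩ => hn (iso_cube_of_realizes_P₂ hH hcard)⟩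

/-! ### Vertices with equal tiles -/

/-- The condition on two darts of the cube under which they may carry the same label: they share
their tail, share their head, or are exchanged by the antipodal map composed with reversal. -/
def DartCompat (x : Vert) (i : Fin 3) (y : Vert) (j : Fin 3) : Prop :=
  x = y ∨ x + dir i = y + dir j ∨ (i = j ∧ y = x + dir i + ones)

instance (x : Vert) (i : Fin 3) (y : Vert) (j : Fin 3) : Decidable (DartCompat x i y j) :=
  inferInstanceAs (Decidable (_ ∨ _))

/-- The tile at a vertex in a labelling of the darts of the cube. -/
def dartTile (l : Vert → Fin 3 → ℤ) (x : Vert) : Multiset ℤ := {l x 0, l x 1, l x 2}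

/-- The vertex that differs from `x` exactly in the two coordinates other than `i`. -/
def mate (x : Vert) (i : Fin 3) : Vert := x + dir i + ones

/-- The vertices `x` and `mate x i` carry the same labels on their darts. Here `-(i + a)` is `i` for
`a = i` and the third direction for `a ≠ i`. -/
def IsTwin (l : Vert → Fin 3 → ℤ) (x : Vert) (i : Fin 3) : Prop :=
  ∀ a, l x a = l (mate x i) (-(i + a))

theorem mem_dartTile {l : Vert → Fin 3 → ℤ} {x : Vert} {z : ℤ} :
    z ∈ dartTile l x ↔ ∃ i, z = l x i := by
  simp only [dartTile, Multiset.insert_eq_cons, Multiset.mem_cons, Multiset.mem_singleton,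
    Fin.exists_fin_succ]
  simp

set_option synthInstance.maxSize 1000 in
-- Distinct vertices have compatible darts only at distance two. There two darts are matched through
-- the common neighbours, the third through the antipodal rule.
theorem matching_of_dartCompat : ∀ (d : Vert) (p q r : Fin 3),
    (DartCompat 0 0 d p) → (DartCompat 0 1 d q) → (DartCompat 0 2 d r) →
      d = 0 ∨ ∃ i, d = mate 0 i ∧ p = -(i + 0) ∧ q = -(i + 1) ∧ r = -(i + 2) := by
  decide

theorem dartCompat_add (z x : Vert) (i : Fin 3) (y : Vert) (j : Fin 3) :
    DartCompat (z + x) i (z + y) j ↔ DartCompat x i y j := by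
  simp only [DartCompat, add_assoc, add_right_inj]

namespace IsCompatible

variable {l : Vert → Fin 3 → ℤ} (hl : IsCompatible l)
include hl

theorem dartCompat {x y : Vert} {i j : Fin 3} (h : l x i = l y j) : DartCompat x i y j :=
  hl.eq_or x i y j h

theorem isTwin_of_dartTile_eq {x y : Vert} (h : dartTile l x = dartTile l y) (hne : x ≠ y) :
    ∃ i, y = mate x i ∧ IsTwin l x i := by
  have hm : ∀ i, ∃ j, l x i = l y j := fun i => by
    rw [← mem_dartTile, ← h, mem_dartTile]
    exact ⟨i, rfl⟩
  choose π hπ using hm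
  obtain ⟨d, rfl⟩ : ∃ d, y = x + d := ⟨y - x, by abel⟩
  have hc : ∀ i, DartCompat 0 i d (π i) := fun i => by
    rw [← dartCompat_add x, add_zero]
    exact hl.dartCompat (hπ i)
  rcases matching_of_dartCompat d _ _ _ (hc 0) (hc 1) (hc 2) with rfl | ⟨i, rfl, h0, h1, h2⟩
  · exact absurd (add_zero x).symm hne
  · have hy : x + mate 0 i = mate x i := by simp only [mate]; abel
    rw [hy] at hπ ⊢
    refine ⟨i, rfl, fun a => ?_⟩
    fin_cases a
    · exact h0 ▸ hπ 0
    · exact h1 ▸ hπ 1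
    · exact h2 ▸ hπ 2

end IsCompatible

theorem mate_mate : ∀ (x : Vert) (i : Fin 3), mate (mate x i) i = x := by decide

theorem IsTwin.mate {l : Vert → Fin 3 → ℤ} {x : Vert} {i : Fin 3} (h : IsTwin l x i) :
    IsTwin l (mate x i) i := by
  intro a
  rw [mate_mate, h]
  congr 1
  clear h
  revert i a; decide

theorem triple_rot (a b c : ℤ) : ({a, b, c} : Multiset ℤ) = {c, a, b} := by
  exact (congrArg (a ::ₘ ·) (Multiset.pair_comm b c)).trans (Multiset.cons_swap a c _)

theorem triple_rev (a b c : ℤ) : ({a, b, c} : Multiset ℤ) = {c, b, a} := by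
  rw [triple_rot]
  exact congrArg _ (Multiset.pair_comm _ _)

theorem IsTwin.dartTile_eq {l : Vert → Fin 3 → ℤ} {x : Vert} {i : Fin 3} (h : IsTwin l x i) :
    dartTile l x = dartTile l (PotCube.mate x i) := by
  unfold dartTile
  rw [h 0, h 1, h 2]
  simp only [Multiset.insert_eq_cons]
  fin_cases i
  · exact congrArg _ (Multiset.pair_comm _ _)
  · exact triple_rev _ _ _
  · exact Multiset.cons_swap _ _ _

/-- The consequences, for two pairs of vertices with equal tiles, of a common edge. -/
def TwinCompat (x : Vert) (i : Fin 3) (y : Vert) (j : Fin 3) : Prop :=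
  ∀ a, (x = y → DartCompat (mate x i) (-(i + a)) (mate y j) (-(j + a))) ∧
    (x + dir a = y →
      DartCompat (mate x i + dir (-(i + a))) (-(i + a)) (mate y j) (-(j + a)))

instance (x : Vert) (i : Fin 3) (y : Vert) (j : Fin 3) : Decidable (TwinCompat x i y j) :=
  inferInstanceAs (Decidable (∀ _, _))

/-- The label of a common dart or edge is copied to both mates, so the local rule applies to the
copies. -/
theorem IsCompatible.twinCompat {l : Vert → Fin 3 → ℤ} (hl : IsCompatible l) {x y : Vert}
    {i j : Fin 3} (hx : IsTwin l x i) (hy : IsTwin l y j) : TwinCompat x i y j := by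
  intro a
  refine ⟨?_, ?_⟩
  · rintro rfl
    exact hl.dartCompat (by rw [← hx, ← hy])
  · rintro rfl
    exact hl.dartCompat (by rw [hl.odd, ← hx, ← hy, hl.odd])

/-- The directions in which pairs of vertices with equal tiles are based agree, and such pairs do
not lie on a common face. -/
theorem eq_of_twinCompat : ∀ (i : Fin 3) (y : Vert) (j : Fin 3), TwinCompat 0 i y j →
    TwinCompat (mate 0 i) i y j → TwinCompat 0 i (mate y j) j →
    TwinCompat (mate 0 i) i (mate y j) j → i = j ∧ ∀ k, y = dir k → k = i := by
  decide

/-! ### Normalization by the symmetries of the cube -/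

/-- Rotation of the coordinates. -/
def rot (x : Vert) : Vert := (x.2.2, x.1, x.2.1)

theorem rot_bijective : Function.Bijective rot := by decide

theorem IsCompatible.rot {l : Vert → Fin 3 → ℤ} (hl : IsCompatible l) :
    IsCompatible fun x i => l (rot x) (i + 1) where
  odd x i := by
    rw [← hl.odd]; congr 1; revert x i; decide
  ne_zero x i := hl.ne_zero _ _
  eq_or x i y j h := by
    have := hl.dartCompat h
    clear h
    change DartCompat (PotCube.rot x) (i + 1) (PotCube.rot y) (j + 1) at this
    change DartCompat x i y j
    have hd : ∀ (x : Vert) i, PotCube.rot x + dir (i + 1) = PotCube.rot (x + dir i) := by decide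
    have ho : ∀ x : Vert, PotCube.rot x + ones = PotCube.rot (x + ones) := by decide
    unfold DartCompat at this ⊢
    rwa [hd, hd, ho, rot_bijective.1.eq_iff, rot_bijective.1.eq_iff, rot_bijective.1.eq_iff,
      add_left_inj] at this

theorem IsCompatible.translate {l : Vert → Fin 3 → ℤ} (hl : IsCompatible l) (z : Vert) :
    IsCompatible fun x i => l (z + x) i where
  odd x i := by rw [← hl.odd, add_assoc]
  ne_zero x i := hl.ne_zero _ _
  eq_or x i y j h := (dartCompat_add z x i y j).1 (hl.dartCompat h)

theorem IsTwin.exists_rot {l : Vert → Fin 3 → ℤ} (hl : IsCompatible l) {i : Fin 3}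
    (h : IsTwin l 0 (i + 1)) : ∃ l', IsCompatible l' ∧ IsTwin l' 0 i ∧
      Set.range (dartTile l') = Set.range (dartTile l) := by
  refine ⟨_, hl.rot, fun a => ?_, ?_⟩
  · have h' := h (a + 1)
    change l 0 (a + 1) = l (PotCube.rot (PotCube.mate 0 i)) (-(i + a) + 1)
    rw [h']
    clear h h'
    congr 1
    · revert i; decide
    · revert i a; decide
  · rw [← rot_bijective.2.range_comp (dartTile l)]
    congr 1
    funext x
    exact triple_rot _ _ _

theorem IsTwin.exists_normalized {l : Vert → Fin 3 → ℤ} (hl : IsCompatible l) {x : Vert}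
    {i : Fin 3} (h : IsTwin l x i) : ∃ l', IsCompatible l' ∧ IsTwin l' 0 2 ∧
      Set.range (dartTile l') = Set.range (dartTile l) := by
  have h0 : IsTwin (fun y i => l (x + y) i) 0 i := fun a => by
    simp only [PotCube.mate, zero_add, add_zero]
    rw [h a, PotCube.mate, add_assoc]
  have hr : Set.range (dartTile fun y i => l (x + y) i) = Set.range (dartTile l) :=
    (Equiv.addLeft x).surjective.range_comp (dartTile l)
  rw [← hr]
  have hl' := hl.translate x
  revert h0 hl'
  generalize (fun y i => l (x + y) i) = m
  intro h0 hm
  -- A rotation lowers the direction by one, and `0 = 2 + 1` in `Fin 3`.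
  have step : ∀ {m : Vert → Fin 3 → ℤ}, IsCompatible m → IsTwin m 0 0 →
      ∃ l', IsCompatible l' ∧ IsTwin l' 0 2 ∧ Set.range (dartTile l') = Set.range (dartTile m) :=
    fun hm h => IsTwin.exists_rot hm h
  fin_cases i
  · exact step hm h0
  · obtain ⟨m', hm', ht, hr⟩ := IsTwin.exists_rot (i := 0) hm h0
    rw [← hr]
    exact step hm' ht
  · exact ⟨m, hm, h0, rfl⟩

/-! ### Twin pairs and numbers of tiles and colors -/

namespace IsCompatible

variable {l : Vert → Fin 3 → ℤ} (hl : IsCompatible l)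
include hl

theorem isTwin_direction {x y : Vert} {i j : Fin 3} (hx : IsTwin l x i) (hy : IsTwin l y j) :
    i = j ∧ ∀ k, y = x + dir k → k = i := by
  obtain ⟨d, rfl⟩ : ∃ d, y = x + d := ⟨y - x, by abel⟩
  have hm : ∀ z k, x + mate z k = mate (x + z) k := fun z k => by simp only [mate, add_assoc]
  have hm' := hl.translate x
  have h0 : IsTwin (fun z k => l (x + z) k) 0 i := fun a => by
    simp only [hm, add_zero]
    exact hx a
  have hd : IsTwin (fun z k => l (x + z) k) d j := fun a => by
    simp only [hm]
    exact hy a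
  have := eq_of_twinCompat i d j (hm'.twinCompat h0 hd) (hm'.twinCompat h0.mate hd)
    (hm'.twinCompat h0 hd.mate) (hm'.twinCompat h0.mate hd.mate)
  exact ⟨this.1, fun k hk => this.2 k (add_left_cancel hk)⟩

theorem isTwin_of_dartTile_eq_of_isTwin (h : IsTwin l 0 2) {x y : Vert}
    (hxy : dartTile l x = dartTile l y) (hne : x ≠ y) :
    y = mate x 2 ∧ IsTwin l x 2 ∧ x ≠ (1, 0, 0) ∧ x ≠ (0, 1, 0) := by
  obtain ⟨i, rfl, hx⟩ := hl.isTwin_of_dartTile_eq hxy hne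
  obtain ⟨rfl, hk⟩ := hl.isTwin_direction h hx
  refine ⟨rfl, hx, ?_, ?_⟩
  · rintro rfl
    exact absurd (hk 0 (by decide)) (by decide)
  · rintro rfl
    exact absurd (hk 1 (by decide)) (by decide)

set_option synthInstance.maxSize 1000 in
-- If `0` and `(1, 1, 0)` were the only twins, dropping one of them would leave seven distinct
-- tiles. The pair `(1, 0, 0)`, `(0, 1, 0)` is excluded by sharing a face with them.
theorem exists_second_isTwin (h : IsTwin l 0 2) (hcard : (Set.range (dartTile l)).encard ≤ 6) :
    IsTwin l (0, 0, 1) 2 ∨ IsTwin l (0, 1, 1) 2 := by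
  by_contra! hn
  have hinj : Set.InjOn (dartTile l) {x | x ≠ (1, 1, 0)} := by
    intro x hx y hy hxy
    by_contra hne
    obtain ⟨rfl, ht, h1, h2⟩ := hl.isTwin_of_dartTile_eq_of_isTwin h hxy hne
    have hcases : ∀ x : Vert, x ≠ (1, 1, 0) → mate x 2 ≠ (1, 1, 0) → x ≠ (1, 0, 0) →
        x ≠ (0, 1, 0) → (x = (0, 0, 1) ∨ mate x 2 = (0, 0, 1)) ∨
          (x = (0, 1, 1) ∨ mate x 2 = (0, 1, 1)) := by decide
    rcases hcases x hx hy h1 h2 with (h | h) | (h | h)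
    · exact hn.1 (h ▸ ht)
    · exact hn.1 (h ▸ ht.mate)
    · exact hn.2 (h ▸ ht)
    · exact hn.2 (h ▸ ht.mate)
  have h7 : ({x | x ≠ (1, 1, 0)} : Set Vert).encard = 7 := by
    rw [Set.encard_eq_coe_toFinset_card]
    rfl
  have := (hinj.encard_image.symm.le.trans
    (Set.encard_le_encard (Set.image_subset_range _ _))).trans hcard
  rw [h7] at this
  exact absurd this (by decide)

/-- Two classes of one color would have equal or opposite labels, making all darts of one class
compatible with all darts, or all reversed darts, of the other. -/
theorem natAbs_injective_of_reps {n : ℕ} (r : Fin n → Fin 2 → Vert × Fin 3)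
    (hr : ∀ s, l (r s 0).1 (r s 0).2 = l (r s 1).1 (r s 1).2)
    (hc : ∀ s t, s ≠ t →
      (∃ a b, ¬ DartCompat (r s a).1 (r s a).2 (r t b).1 (r t b).2) ∧
      ∃ a b, ¬ DartCompat (r s a).1 (r s a).2 ((r t b).1 + dir (r t b).2) (r t b).2) :
    Function.Injective fun s => (l (r s 0).1 (r s 0).2).natAbs := by
  have hr' : ∀ s a, l (r s a).1 (r s a).2 = l (r s 0).1 (r s 0).2 := by
    intro s a
    fin_cases a
    · rfl
    · exact (hr s).symm
  intro s t hst
  by_contra hne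
  obtain ⟨⟨a, b, hab⟩, c, d, hcd⟩ := hc s t hne
  rcases Int.natAbs_eq_natAbs_iff.1 hst with h | h
  · exact hab (hl.dartCompat (by rw [hr' s, hr' t, h]))
  · exact hcd (hl.dartCompat (by rw [hl.odd, hr' s, hr' t, h]))

end IsCompatible

/-- Pairs of darts with equal labels if `0` and `(0, 0, 1)` both have twins in direction `2`. -/
def reps : Fin 5 → Fin 2 → Vert × Fin 3 :=
  ![![((1, 0, 0), 0), ((1, 0, 0), 1)], ![((0, 1, 0), 1), ((0, 1, 0), 0)],
    ![((0, 0, 0), 2), ((1, 1, 0), 2)], ![((0, 1, 1), 0), ((0, 1, 1), 1)],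
    ![((1, 0, 1), 1), ((1, 0, 1), 0)]]

/-- Pairs of darts with equal labels if `0` and `(0, 1, 1)` both have twins in direction `2`. -/
def reps' : Fin 6 → Fin 2 → Vert × Fin 3 :=
  ![![((1, 0, 0), 0), ((1, 0, 0), 1)], ![((0, 1, 0), 1), ((0, 1, 0), 0)],
    ![((0, 0, 0), 2), ((1, 1, 0), 2)], ![((0, 1, 1), 2), ((1, 0, 1), 2)],
    ![((1, 1, 1), 0), ((1, 1, 1), 1)], ![((0, 0, 1), 1), ((0, 0, 1), 0)]]

set_option synthInstance.maxSize 1000 in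
theorem reps_not_compat : ∀ s t, s ≠ t →
      (∃ a b, ¬ DartCompat (reps s a).1 (reps s a).2 (reps t b).1 (reps t b).2) ∧
      ∃ a b, ¬ DartCompat (reps s a).1 (reps s a).2 ((reps t b).1 + dir (reps t b).2)
        (reps t b).2 := by
  decide

set_option synthInstance.maxSize 1000 in
theorem reps'_not_compat : ∀ s t, s ≠ t →
      (∃ a b, ¬ DartCompat (reps' s a).1 (reps' s a).2 (reps' t b).1 (reps' t b).2) ∧
      ∃ a b, ¬ DartCompat (reps' s a).1 (reps' s a).2 ((reps' t b).1 + dir (reps' t b).2)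
        (reps' t b).2 := by
  decide

theorem encard_range_of_injective {n : ℕ} {f : Fin n → ℕ} (hf : Function.Injective f) :
    (Set.range f).encard = n := by
  rw [← Set.image_univ, hf.encard_image, Set.encard_univ, ENat.card_eq_coe_fintype_card,
    Fintype.card_fin]

namespace IsCompatible

variable {l : Vert → Fin 3 → ℤ} (hl : IsCompatible l)
include hl

/-- The first two equalities are the twin equalities read from the common neighbours of the twins.
-/
theorem labels_of_isTwin (h : IsTwin l 0 2) :
    l (1, 0, 0) 0 = l (1, 0, 0) 1 ∧ l (0, 1, 0) 1 = l (0, 1, 0) 0 ∧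
      l (0, 0, 0) 2 = l (1, 1, 0) 2 := by
  have h0 : -l (0, 0, 0) 0 = -l (1, 1, 0) 1 := congrArg _ (h 0)
  have h1 : -l (0, 0, 0) 1 = -l (1, 1, 0) 0 := congrArg _ (h 1)
  rw [← hl.odd, ← hl.odd] at h0 h1
  exact ⟨h0, h1, h 2⟩

theorem not_isTwin_of_encard_le {C : Set ℕ} (hC : ∀ x i, (l x i).natAbs ∈ C)
    (hcard : C.encard ≤ 5) (h : IsTwin l 0 2) : ¬ IsTwin l (0, 1, 1) 2 := by
  intro h'
  obtain ⟨ha, hb, hc⟩ := hl.labels_of_isTwin h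
  have h0 : -l (0, 1, 1) 0 = -l (1, 0, 1) 1 := congrArg _ (h' 0)
  have h1 : -l (0, 1, 1) 1 = -l (1, 0, 1) 0 := congrArg _ (h' 1)
  rw [← hl.odd, ← hl.odd] at h0 h1
  have hinj := hl.natAbs_injective_of_reps reps' (by
    intro s
    fin_cases s
    exacts [ha, hb, hc, h' 2, h0, h1]) reps'_not_compat
  have := (encard_range_of_injective hinj).symm.le.trans
    ((Set.encard_le_encard (Set.range_subset_iff.2 fun s => hC _ _)).trans hcard)
  exact absurd this (by decide)

/-- Each of the other two candidate pairs shares a face with one of the given pairs, so no further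
tiles coincide. -/
theorem encard_range_dartTile_of_isTwin (h : IsTwin l 0 2) (h' : IsTwin l (0, 0, 1) 2) :
    6 ≤ (Set.range (dartTile l)).encard := by
  have hinj : Set.InjOn (dartTile l) {x | x ≠ (1, 1, 0) ∧ x ≠ (1, 1, 1)} := by
    intro x hx y hy hxy
    by_contra hne
    obtain ⟨rfl, ht, h1, h2⟩ := hl.isTwin_of_dartTile_eq_of_isTwin h hxy hne
    have hcases : ∀ x : Vert, (x ≠ (1, 1, 0) ∧ x ≠ (1, 1, 1)) →
        (mate x 2 ≠ (1, 1, 0) ∧ mate x 2 ≠ (1, 1, 1)) → x ≠ (1, 0, 0) →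
        x ≠ (0, 1, 0) → x = (0, 0, 1) + dir 0 ∨ x = (0, 0, 1) + dir 1 := by decide
    rcases hcases x hx hy h1 h2 with h | h
    · exact absurd ((hl.isTwin_direction h' ht).2 _ h) (by decide)
    · exact absurd ((hl.isTwin_direction h' ht).2 _ h) (by decide)
  have h6 : ({x | x ≠ (1, 1, 0) ∧ x ≠ (1, 1, 1)} : Set Vert).encard = 6 := by
    rw [Set.encard_eq_coe_toFinset_card]
    rfl
  rw [← h6, ← hinj.encard_image]
  exact Set.encard_le_encard (Set.image_subset_range _ _)

end IsCompatible

/-! ### Recoloring pots -/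

section PotIso

theorem mem_signedColors {P : Set (Multiset ℤ)} {z : ℤ} :
    z ∈ signedColors P ↔ z ≠ 0 ∧ ∃ t ∈ P, z ∈ t ∨ -z ∈ t := by
  simp only [signedColors, colors, Set.mem_ofPred_eq, Int.natAbs_pos]
  refine and_congr_right fun _ => ?_
  rcases Int.natAbs_eq z with h | h
  · rw [← h]
  · have h' : ((z.natAbs : ℕ) : ℤ) = -z := by omega
    rw [h', neg_neg]
    simp only [or_comm]

/-- The required map is the inverse of `g` on signed colors; the value `0` elsewhere keeps it odd on
all integers. -/
theorem potIso_image {P : Set (Multiset ℤ)} (hP : ∀ t ∈ P, (0 : ℤ) ∉ t) {g : ℤ → ℤ}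
    (hodd : ∀ z, g (-z) = -g z) (hinj : Set.InjOn g (signedColors P)) :
    PotIso (Multiset.map g '' P) P := by
  classical
  have hneg : ∀ z, z ∈ signedColors P → -z ∈ signedColors P := by
    intro z
    simp only [mem_signedColors, neg_neg, ne_eq, neg_eq_zero, or_comm, imp_self]
  have hmem : ∀ t ∈ P, ∀ z ∈ t, z ∈ signedColors P := fun t ht z hz =>
    mem_signedColors.2 ⟨fun h => hP t ht (h ▸ hz), t, ht, .inl hz⟩
  have hg0 : ∀ z ∈ signedColors P, g z ≠ 0 := by
    intro z hz h0
    have := hinj hz (hneg z hz) (by rw [hodd, h0, neg_zero])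
    exact (mem_signedColors.1 hz).1 (by omega)
  let f : ℤ → ℤ := fun y =>
    if h : ∃ z ∈ signedColors P, g z = y then h.choose else 0
  have hf : ∀ z ∈ signedColors P, f (g z) = z := by
    intro z hz
    have h : ∃ z' ∈ signedColors P, g z' = g z := ⟨z, hz, rfl⟩
    simp only [f, dif_pos h]
    exact hinj h.choose_spec.1 hz h.choose_spec.2
  have hS : signedColors (Multiset.map g '' P) = g '' signedColors P := by
    ext y
    rw [mem_signedColors]
    constructor
    · rintro ⟨-, _, ⟨t, ht, rfl⟩, h | h⟩
      · obtain ⟨z, hz, rfl⟩ := Multiset.mem_map.1 h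
        exact ⟨z, hmem t ht z hz, rfl⟩
      · obtain ⟨z, hz, hzy⟩ := Multiset.mem_map.1 h
        exact ⟨-z, hneg z (hmem t ht z hz), by rw [hodd, hzy, neg_neg]⟩
    · rintro ⟨z, hz, rfl⟩
      refine ⟨hg0 z hz, ?_⟩
      obtain ⟨-, t, ht, h⟩ := mem_signedColors.1 hz
      refine ⟨_, ⟨t, ht, rfl⟩, h.imp (Multiset.mem_map_of_mem g) fun h => ?_⟩
      rw [← hodd]
      exact Multiset.mem_map_of_mem g h
  refine ⟨f, fun y => ?_, ?_, ?_⟩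
  · by_cases h : ∃ z ∈ signedColors P, g z = y
    · obtain ⟨z, hz, rfl⟩ := h
      rw [← hodd, hf z hz, hf _ (hneg z hz)]
    · have h' : ¬ ∃ z ∈ signedColors P, g z = -y := by
        rintro ⟨z, hz, hzy⟩
        exact h ⟨-z, hneg z hz, by rw [hodd, hzy, neg_neg]⟩
      simp only [f, dif_neg h, dif_neg h', neg_zero]
  · rw [hS]
    refine ⟨?_, ?_, ?_⟩
    · rintro _ ⟨z, hz, rfl⟩
      rwa [hf z hz]
    · rintro _ ⟨z, hz, rfl⟩ _ ⟨z', hz', rfl⟩ h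
      rw [hf z hz, hf z' hz'] at h
      rw [h]
    · exact fun z hz => ⟨g z, ⟨z, hz, rfl⟩, hf z hz⟩
  · rw [Set.image_image]
    refine (Set.image_congr fun t ht => ?_).trans (Set.image_id P)
    exact (Multiset.map_map f g t).trans
      ((Multiset.map_congr rfl fun z hz => hf z (hmem t ht z hz)).trans (Multiset.map_id' t))

/-- The odd map on the integers with values `w` at `1, …, 5`. -/
def oddExt (w : Fin 5 → ℤ) (z : ℤ) : ℤ :=
  -- At `z = 0` the subtraction truncates to index `0`, but the sign kills the value.
  z.sign * if h : z.natAbs - 1 < 5 then w ⟨z.natAbs - 1, h⟩ else 0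

theorem oddExt_neg (w : Fin 5 → ℤ) (z : ℤ) : oddExt w (-z) = -oddExt w z := by
  simp only [oddExt, Int.sign_neg, Int.natAbs_neg, neg_mul]

theorem oddExt_injOn {w : Fin 5 → ℤ} (hw : ∀ s, w s ≠ 0)
    (hinj : Function.Injective fun s => (w s).natAbs) :
    Set.InjOn (oddExt w) {z | 1 ≤ z.natAbs ∧ z.natAbs ≤ 5} := by
  rintro z ⟨hz1, hz5⟩ y ⟨hy1, hy5⟩ h
  have hz : z.natAbs - 1 < 5 := by omega
  have hy : y.natAbs - 1 < 5 := by omega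
  simp only [oddExt, dif_pos hz, dif_pos hy] at h
  have h' := congrArg Int.natAbs h
  rw [Int.natAbs_mul, Int.natAbs_mul, Int.natAbs_sign_of_ne_zero (by omega),
    Int.natAbs_sign_of_ne_zero (by omega), one_mul, one_mul] at h'
  have hs := hinj h'
  rw [hs] at h
  have hsign := mul_right_cancel₀ (hw _) h
  have habs : z.natAbs = y.natAbs := by
    have := congrArg Fin.val hs
    simp only at this
    omega
  rw [← Int.sign_mul_natAbs z, ← Int.sign_mul_natAbs y, hsign, habs]

theorem signedColors_subset {P : Set (Multiset ℤ)} (h : ∀ t ∈ P, ∀ z ∈ t, z.natAbs ≤ 5) :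
    signedColors P ⊆ {z | 1 ≤ z.natAbs ∧ z.natAbs ≤ 5} := by
  intro z hz
  obtain ⟨h0, t, ht, hz | hz⟩ := mem_signedColors.1 hz
  · have := h t ht _ hz
    exact ⟨by omega, this⟩
  · have := h t ht _ hz
    exact ⟨by omega, by omega⟩

theorem potIso_P₁ {w : Fin 5 → ℤ} (hw : ∀ s, w s ≠ 0)
    (hinj : Function.Injective fun s => (w s).natAbs) :
    PotIso {{w 0, w 0, w 0}, {w 1, w 1, w 1}, {-w 1, -w 2, -w 2}, {-w 0, -w 3, -w 3},
      {-w 0, w 2, -w 4}, {-w 1, w 3, w 4}} P₁ := by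
  have := potIso_image (P := P₁) (by simp [P₁]) (oddExt_neg w)
    ((oddExt_injOn hw hinj).mono (signedColors_subset (by simp [P₁])))
  convert this using 1
  simp [P₁, Set.image_insert_eq, oddExt, show Int.sign 2 = 1 from rfl, show Int.sign 3 = 1 from rfl,
    show Int.sign 4 = 1 from rfl, show Int.sign 5 = 1 from rfl]

theorem potIso_P₂ {w : Fin 5 → ℤ} (hw : ∀ s, w s ≠ 0)
    (hinj : Function.Injective fun s => (w s).natAbs) :
    PotIso {{w 0, w 0, w 0}, {w 1, w 1, w 1}, {-w 1, -w 2, -w 2}, {-w 0, -w 3, -w 3},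
      {w 2, w 3, w 4}, {-w 0, -w 1, -w 4}} P₂ := by
  have := potIso_image (P := P₂) (by simp [P₂]) (oddExt_neg w)
    ((oddExt_injOn hw hinj).mono (signedColors_subset (by simp [P₂])))
  convert this using 1
  simp [P₂, Set.image_insert_eq, oddExt, show Int.sign 2 = 1 from rfl, show Int.sign 3 = 1 from rfl,
    show Int.sign 4 = 1 from rfl, show Int.sign 5 = 1 from rfl]

end PotIso

/-! ### Reading off the two pots -/

set_option synthInstance.maxSize 1000 in
-- Classes `0` and `4` sit at the two ends `(1, 0, 0)` and `(1, 0, 1)` of this edge.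
theorem reps_compat_left : ∀ s : Fin 5,
    ((∀ a, DartCompat (1, 0, 0) 2 (reps s a).1 (reps s a).2) → s = 0) ∧
    ((∀ a, DartCompat (1, 0, 0) 2 ((reps s a).1 + dir (reps s a).2) (reps s a).2) → s = 4) := by
  decide

set_option synthInstance.maxSize 1000 in
theorem reps_compat_right : ∀ s : Fin 5,
    ((∀ a, DartCompat (0, 1, 0) 2 (reps s a).1 (reps s a).2) → s = 1) ∧
    ((∀ a, DartCompat (0, 1, 0) 2 ((reps s a).1 + dir (reps s a).2) (reps s a).2) → s = 3) := by
  decide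

/-- The five classes of `reps` cover ten edges; `g` and `k` label the other two. -/
theorem range_dartTile {l : Vert → Fin 3 → ℤ} (hl : IsCompatible l) (h : IsTwin l 0 2)
    (h' : IsTwin l (0, 0, 1) 2) {a b c d e g k : ℤ}
    (ha : ∀ s, l (reps 0 s).1 (reps 0 s).2 = a) (hb : ∀ s, l (reps 1 s).1 (reps 1 s).2 = b)
    (hc : ∀ s, l (reps 2 s).1 (reps 2 s).2 = c) (hd : ∀ s, l (reps 3 s).1 (reps 3 s).2 = d)
    (he : ∀ s, l (reps 4 s).1 (reps 4 s).2 = e) (hg : l (1, 0, 0) 2 = g)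
    (hk : l (0, 1, 0) 2 = k) :
    Set.range (dartTile l) =
      {{g, a, a}, {k, b, b}, {-k, d, d}, {-g, e, e}, {-a, -b, c}, {-d, -e, -c}} := by
  have odd : ∀ {x y : Vert} {i : Fin 3} {z : ℤ}, l x i = z → x + dir i = y → l y i = -z := by
    rintro x _ i _ rfl rfl
    exact hl.odd x i
  have tile_eq : ∀ {x : Vert} {z₀ z₁ z₂ : ℤ}, l x 0 = z₀ → l x 1 = z₁ → l x 2 = z₂ →
      dartTile l x = {z₀, z₁, z₂} := by
    rintro x _ _ _ rfl rfl rfl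
    rfl
  have t100 : dartTile l (1, 0, 0) = {g, a, a} :=
    (tile_eq (ha 0) (ha 1) hg).trans (triple_rot _ _ _)
  have t010 : dartTile l (0, 1, 0) = {k, b, b} :=
    (tile_eq (hb 1) (hb 0) hk).trans (triple_rot _ _ _)
  have t011 : dartTile l (0, 1, 1) = {-k, d, d} :=
    (tile_eq (hd 0) (hd 1) (odd hk (by decide))).trans (triple_rot _ _ _)
  have t101 : dartTile l (1, 0, 1) = {-g, e, e} :=
    (tile_eq (he 1) (he 0) (odd hg (by decide))).trans (triple_rot _ _ _)
  have t000 : dartTile l (0, 0, 0) = {-a, -b, c} :=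
    tile_eq (odd (ha 0) (by decide)) (odd (hb 0) (by decide)) (hc 0)
  have t111 : dartTile l (1, 1, 1) = {-d, -e, -c} :=
    tile_eq (odd (hd 0) (by decide)) (odd (he 0) (by decide)) (odd (hc 1) (by decide))
  have t110 : dartTile l (1, 1, 0) = {-a, -b, c} := h.dartTile_eq.symm.trans t000
  have t001 : dartTile l (0, 0, 1) = {-d, -e, -c} := h'.dartTile_eq.trans t111
  ext t
  simp only [Set.mem_insert_iff, Set.mem_singleton_iff]
  constructor
  · rintro ⟨⟨x, y, z⟩, rfl⟩
    fin_cases x <;> fin_cases y <;> fin_cases z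
    exacts [.inr (.inr (.inr (.inr (.inl t000)))), .inr (.inr (.inr (.inr (.inr t001)))),
      .inr (.inl t010), .inr (.inr (.inl t011)), .inl t100, .inr (.inr (.inr (.inl t101))),
      .inr (.inr (.inr (.inr (.inl t110)))), .inr (.inr (.inr (.inr (.inr t111))))]
  · rintro (rfl | rfl | rfl | rfl | rfl | rfl)
    exacts [⟨_, t100⟩, ⟨_, t010⟩, ⟨_, t011⟩, ⟨_, t101⟩, ⟨_, t000⟩, ⟨_, t111⟩]

theorem potIso_of_isTwin {l : Vert → Fin 3 → ℤ} (hl : IsCompatible l) (h : IsTwin l 0 2)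
    (h' : IsTwin l (0, 0, 1) 2) {C : Set ℕ} (hC : ∀ x i, (l x i).natAbs ∈ C)
    (hcard : C.encard ≤ 5) :
    C.encard = 5 ∧
      (PotIso (Set.range (dartTile l)) P₁ ∨ PotIso (Set.range (dartTile l)) P₂) := by
  obtain ⟨ha, hb, hc⟩ := hl.labels_of_isTwin h
  have h0 : -l (0, 0, 1) 0 = -l (1, 1, 1) 1 := congrArg _ (h' 0)
  have h1 : -l (0, 0, 1) 1 = -l (1, 1, 1) 0 := congrArg _ (h' 1)
  rw [← hl.odd, ← hl.odd] at h0 h1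
  have hr : ∀ s, l (reps s 0).1 (reps s 0).2 = l (reps s 1).1 (reps s 1).2 := by
    intro s
    fin_cases s
    exacts [ha, hb, hc, h1.symm, h0.symm]
  have hr' : ∀ s a, l (reps s a).1 (reps s a).2 = l (reps s 0).1 (reps s 0).2 := by
    intro s a
    fin_cases a
    · rfl
    · exact (hr s).symm
  have hinj := hl.natAbs_injective_of_reps reps hr reps_not_compat
  generalize hv : (fun s => l (reps s 0).1 (reps s 0).2) = v
  have hv' : ∀ s a, l (reps s a).1 (reps s a).2 = v s := fun s a => (hr' s a).trans (congrFun hv s)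
  have hvinj : Function.Injective fun s => (v s).natAbs := by rw [← hv]; exact hinj
  have hv0 : ∀ s, v s ≠ 0 := fun s => hv' s 0 ▸ hl.ne_zero _ _
  have hsub : Set.range (fun s => (v s).natAbs) ⊆ C :=
    Set.range_subset_iff.2 fun s => hv' s 0 ▸ hC _ _
  have h5 : (Set.range fun s => (v s).natAbs).encard = 5 := encard_range_of_injective hvinj
  have hfin : C.Finite := Set.finite_of_encard_le_coe (k := 5) hcard
  -- The classes exhaust the colors, so the two remaining edges must repeat one of them.
  have hCeq := hfin.eq_of_subset_of_encard_le' hsub (hcard.trans h5.symm.le)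
  refine ⟨hCeq ▸ h5, ?_⟩
  have hval : ∀ x i, ∃ s, l x i = v s ∨ l x i = -v s := fun x i => by
    have := hC x i
    rw [← hCeq] at this
    obtain ⟨s, hs⟩ := this
    exact ⟨s, Int.natAbs_eq_natAbs_iff.1 hs.symm⟩
  have hcompat : ∀ x i s, (l x i = v s → ∀ a, DartCompat x i (reps s a).1 (reps s a).2) ∧
      (l x i = -v s → ∀ a, DartCompat x i ((reps s a).1 + dir (reps s a).2) (reps s a).2) :=
    fun x i s => ⟨fun h a => hl.dartCompat (h.trans (hv' s a).symm),
      fun h a => hl.dartCompat (by rw [h, hl.odd, hv' s a])⟩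
  have hg : l (1, 0, 0) 2 = v 0 ∨ l (1, 0, 0) 2 = -v 4 := by
    obtain ⟨s, hs | hs⟩ := hval (1, 0, 0) 2
    · exact .inl ((reps_compat_left s).1 ((hcompat _ _ s).1 hs) ▸ hs)
    · exact .inr ((reps_compat_left s).2 ((hcompat _ _ s).2 hs) ▸ hs)
  have hk : l (0, 1, 0) 2 = v 1 ∨ l (0, 1, 0) 2 = -v 3 := by
    obtain ⟨s, hs | hs⟩ := hval (0, 1, 0) 2
    · exact .inl ((reps_compat_right s).1 ((hcompat _ _ s).1 hs) ▸ hs)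
    · exact .inr ((reps_compat_right s).2 ((hcompat _ _ s).2 hs) ▸ hs)
  have hne : ∀ w : Fin 5 → ℤ, (∃ σ : Equiv.Perm (Fin 5), ∀ s, w s = v (σ s) ∨ w s = -v (σ s)) →
      (∀ s, w s ≠ 0) ∧ Function.Injective fun s => (w s).natAbs := by
    rintro w ⟨σ, hσ⟩
    have heq : (fun s => (w s).natAbs) = (fun s => (v s).natAbs) ∘ σ :=
      funext fun s => Int.natAbs_eq_natAbs_iff.2 (hσ s)
    refine ⟨fun s => ?_, heq ▸ hvinj.comp σ.injective⟩
    have := hv0 (σ s)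
    rcases hσ s with h | h <;> rw [h]
    · exact this
    · exact neg_ne_zero.2 this
  rcases hg with hg | hg <;> rcases hk with hk | hk <;>
    rw [range_dartTile hl h h' (hv' 0) (hv' 1) (hv' 2) (hv' 3) (hv' 4) hg hk]
  -- In each case `w` lists the labels playing the roles of `1, …, 5`; its first two entries are
  -- those filling a whole tile.
  · obtain ⟨hw, hi⟩ := hne ![v 0, v 1, -v 3, -v 4, -v 2]
      ⟨Equiv.ofBijective ![0, 1, 3, 4, 2] (by decide), fun s => by
        fin_cases s <;> simp⟩
    right
    convert potIso_P₂ hw hi using 1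
    ext t
    simp [-Multiset.insert_eq_cons]
    tauto
  · obtain ⟨hw, hi⟩ := hne ![v 0, v 3, -v 1, -v 4, -v 2]
      ⟨Equiv.ofBijective ![0, 3, 1, 4, 2] (by decide), fun s => by
        fin_cases s <;> simp⟩
    left
    convert potIso_P₁ hw hi using 1
    ext t
    simp [-Multiset.insert_eq_cons]
    tauto
  · obtain ⟨hw, hi⟩ := hne ![v 1, v 4, -v 0, -v 3, -v 2]
      ⟨Equiv.ofBijective ![1, 4, 0, 3, 2] (by decide), fun s => by
        fin_cases s <;> simp⟩
    left
    convert potIso_P₁ hw hi using 1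
    have hs1 : ({-v 0, -v 1, v 2} : Multiset ℤ) = {-v 1, -v 0, v 2} := Multiset.cons_swap _ _ _
    have hs2 : ({-v 3, -v 4, -v 2} : Multiset ℤ) = {-v 4, -v 3, -v 2} := Multiset.cons_swap _ _ _
    rw [hs1, hs2]
    ext t
    simp [-Multiset.insert_eq_cons]
    tauto
  · obtain ⟨hw, hi⟩ := hne ![v 3, v 4, -v 0, -v 1, v 2]
      ⟨Equiv.ofBijective ![3, 4, 0, 1, 2] (by decide), fun s => by
        fin_cases s <;> simp⟩
    right
    convert potIso_P₂ hw hi using 1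
    ext t
    simp [-Multiset.insert_eq_cons]
    tauto

theorem exists_isTwin {l : Vert → Fin 3 → ℤ} (hl : IsCompatible l)
    (hcard : (Set.range (dartTile l)).encard ≤ 6) : ∃ x i, IsTwin l x i := by
  by_contra! hn
  have hinj : Function.Injective (dartTile l) := fun x y hxy => by
    by_contra hne
    obtain ⟨i, -, h⟩ := hl.isTwin_of_dartTile_eq hxy hne
    exact hn x i h
  rw [← Set.image_univ, hinj.encard_image, Set.encard_univ, ENat.card_eq_coe_fintype_card,
    card_vert] at hcard
  exact absurd hcard (by decide)

theorem classification {l : Vert → Fin 3 → ℤ} (hl : IsCompatible l)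
    (htile : (Set.range (dartTile l)).encard ≤ 6)
    (hcol : (colors (Set.range (dartTile l))).encard ≤ 5) :
    (6 ≤ (Set.range (dartTile l)).encard ∧ (colors (Set.range (dartTile l))).encard = 5) ∧
      (PotIso (Set.range (dartTile l)) P₁ ∨ PotIso (Set.range (dartTile l)) P₂) := by
  obtain ⟨x, i, hx⟩ := exists_isTwin hl htile
  obtain ⟨m, hm, ht, hr⟩ := hx.exists_normalized hl
  rw [← hr] at htile hcol ⊢
  have hC : ∀ x i, (m x i).natAbs ∈ colors (Set.range (dartTile m)) := fun x i =>
    (mem_signedColors (P := Set.range (dartTile m))).2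
      ⟨hm.ne_zero x i, _, ⟨x, rfl⟩, .inl (mem_dartTile.2 ⟨i, rfl⟩)⟩
  have ht' := (hm.exists_second_isTwin ht htile).resolve_right
    (hm.not_isTwin_of_encard_le hC hcol ht)
  have := potIso_of_isTwin hm ht ht' hC hcol
  exact ⟨⟨hm.encard_range_dartTile_of_isTwin ht ht', this.1⟩, this.2⟩

/-! ### Upper bounds and minimality -/

theorem encard_P₂_le : P₂.encard ≤ 6 := by
  rw [← range_tile₂, ← Set.image_univ]
  refine (Set.encard_image_le _ _).trans ?_
  rw [Set.encard_univ, ENat.card_eq_coe_fintype_card, Fintype.card_fin]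
  rfl

theorem encard_colors_P₂_le : (colors P₂).encard ≤ 5 := by
  have hsub : colors P₂ ⊆ (Finset.Icc 1 5 : Finset ℕ) := by
    intro n hn
    have h := signedColors_subset (P := P₂) (by simp [P₂]) (a := (n : ℤ)) (by simpa [signedColors])
    simpa using h
  refine (Set.encard_le_encard hsub).trans ?_
  rw [Set.encard_coe_eq_coe_finsetCard]
  rfl

theorem Realizes3.mono {P P' : Set (Multiset ℤ)} {G : MultiGraph} (h : Realizes3 P G)
    (hsub : P' ⊆ P) (hP' : Realizes P' G) : Realizes3 P' G :=
  ⟨hP', fun ⟨H, ⟨o, col, hcol, hH⟩, hH'⟩ => h.2 ⟨H, ⟨o, col, hcol, hH.trans hsub⟩, hH'⟩⟩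

end PotCube

open PotCube in
theorem mainTheorem1 (P : Set (Multiset ℤ))
    (hP : PotCube.IsBiminimal3 P PotCube.cube) :
    (P.encard = 6 ∧ (PotCube.colors P).encard = 5) ∧
      (PotCube.PotIso P PotCube.P₁ ∨ PotCube.PotIso P PotCube.P₂) := by
  obtain ⟨h3, hT, hB⟩ := hP
  have hT6 : P.encard ≤ 6 :=
    (hT.le.trans (sInf_le ⟨P₂, realizes3_cube_P₂, rfl⟩)).trans encard_P₂_le
  have hB5 : (colors P).encard ≤ 5 :=
    (hB.le.trans (sInf_le ⟨P₂, realizes3_cube_P₂, rfl⟩)).trans encard_colors_P₂_le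
  obtain ⟨o, col, hcol, hsub⟩ := id h3.1
  -- The induced pot also 3-realizes the cube, so minimality of `|P|` leaves no unused tile.
  have hI : inducedPot o col = P :=
    (Set.finite_of_encard_le_coe (k := 6) hT6).eq_of_subset_of_encard_le' hsub
      (hT.le.trans (sInf_le ⟨_, h3.mono hsub ⟨o, col, hcol, subset_rfl⟩, rfl⟩))
  have hrange : Set.range (dartTile (label o col)) = P := by
    rw [← hI]
    exact congrArg Set.range (funext fun x => (tile_cube o col x).symm)
  have hl := isCompatible_label h3 hcol hsub
  have := classification hl (hrange.symm ▸ hT6) (hrange.symm ▸ hB5)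
  rw [hrange] at this
  exact ⟨⟨le_antisymm hT6 this.1.1, this.1.2⟩, this.2⟩
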